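/- Let $G$ be a countable amenable group (there are non-empty finite sets $F_n\subseteq G$ with $|F_n\triangle F_ng|=o(|F_n|)$ for every $g\in G$), let $\Sigma$ be a finite alphabet, and let $G$ act on $\Sigma^G$ by $(gx)_k=x_{g^{-1}k}$. Let $\Theta$ be a standard Borel space on which $G$ acts by measurable maps. For $\theta\in\Theta$ let $X_\theta\subseteq\Sigma^G$ be a closed set such that $\Omega=\{(\theta,x):\theta\in\Theta,\ x\in X_\theta\}$ is measurable in $\Theta\times\Sigma^G$ and $X_{g\theta}=gX_\theta$ for all $g\in G$ and $\theta\in\Theta$. Write $\mathcal F_\Theta$ and $\xi^B$ ($B\subseteq G$) for the $\sigma$-algebras on $\Omega$ generated by $(\theta,x)\mapsto\theta$ and by $(\theta,x)\mapsto x_B$, respectively. Assume that $\Omega$ has the weak topological Markov property relative to $\Theta$: for every finite $A\subseteq G$ there is a finite $B\supseteq A$ such that, for all $\theta\in\Theta$ and $x,x'\in X_\theta$ with $x_{B\setminus A}=x'_{B\setminus A}$, the configuration equal to $x$ on $B$ and to $x'$ on $G\setminus A$ belongs to $X_\theta$. Let $\Phi=(\Phi_A)_{A\subseteq G\text{ finite}}$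 be an absolutely summable relative interaction: each $\Phi_A:\Omega\to\mathbb R$ is bounded and $(\mathcal F_\Theta\vee\xi^A)$-measurable, $\Phi_{gA}(\theta,x)=\Phi_A(g^{-1}\theta,g^{-1}x)$ for all $g\in G$, and $\sum_{A\ni 1_G}\|\Phi_A\|_\infty<\infty$. For finite $A\subseteq G$ put $E_{A|A^c}(\theta,x)=\sum_{C\text{ finite},\,C\cap A\ne\varnothing}\Phi_C(\theta,x)$. For $(\theta,x)\in\Omega$ let $K_A((\theta,x),\cdot)$ be the law of $(\theta,\,u\vee x_{G\setminus A})$, where $u\vee x_{G\setminus A}$ is the configuration equal to $u$ on $A$ and to $x$ off $A$, and the random pattern $u\in\Sigma^A$ has probability proportional to $e^{-E_{A|A^c}(\theta,\,u\vee x_{G\setminus A})}$ if $u\vee x_{G\setminus A}\in X_\theta$, and probability $0$ otherwise. A probability measure $\mu$ on $\Omega$ is a relative Gibbs measure for $\Phi$ if for every finite $A\subseteq G$ and every measurable $W\subseteq\Omega$ one has $\mu(W\mid\mathcal F_\Theta\vee\xi^{G\setminus A})=K_A(\cdot,W)$ $\mu$-almost surely. Let $\nu$ be a $G$-invariant probability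 measure on $\Theta$ such that $X_\theta\neq\varnothing$ for $\nu$-almost every $\theta$. Then there exists a relative Gibbs measure for $\Phi$ that is invariant under the action $g(\theta,x)=(g\theta,gx)$ of $G$ on $\Omega$ and whose marginal on $\Theta$ is $\nu$. -/

import Mathlib

open MeasureTheory Filter Topology
open scoped symmDiff

/-- A (countable) group is amenable if it has a right Følner sequence: non-empty finite sets `F n`
with `|F n ∆ F n g| = o(|F n|)` for every `g`. -/
def HasRightFolnerSequence (G : Type*) [Group G] : Prop :=
  ∃ F : ℕ → Finset G, (∀ n, (F n).Nonempty) ∧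
    ∀ g : G, Tendsto
      (fun n => (((F n : Set G) ∆ ((fun h => h * g) '' (F n : Set G))).ncard : ℝ) / ((F n).card : ℝ))
      atTop (𝓝 0)

/-- The shift of a configuration: `(g x)_k = x_{g⁻¹ k}`. -/
def shiftConfig {G S : Type*} [Group G] (g : G) (x : G → S) : G → S := fun k => x (g⁻¹ * k)

open Classical in
/-- `u ∨ x_{G \ A}`: the configuration equal to the pattern `u` on `A` and to `x` off `A`. -/
noncomputable def patchConfig {G S : Type*} (A : Finset G) (u : A → S) (x : G → S) : G → S :=
  fun k => if h : k ∈ A then u ⟨k, h⟩ else x k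

/-- A relative system: a family of closed sets `X θ` of configurations, indexed by the environments
`θ`, with measurable total space and translation symmetry. -/
structure RelativeSystem (G Θ S : Type*) [Group G] [MulAction G Θ] [MeasurableSpace Θ]
    [TopologicalSpace S] [MeasurableSpace S] where
  /-- The configurations consistent with the environment `θ`. -/
  X : Θ → Set (G → S)
  isClosed_X : ∀ θ, IsClosed (X θ)
  measurableSet_total : MeasurableSet {p : Θ × (G → S) | p.2 ∈ X p.1}
  X_smul : ∀ (g : G) (θ : Θ), X (g • θ) = shiftConfig g '' X θ

namespace RelativeSystem

section Basic

variable {G Θ S : Type*} [Group G] [MulAction G Θ] [MeasurableSpace Θ]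
  [TopologicalSpace S] [MeasurableSpace S] (R : RelativeSystem G Θ S)

/-- The space `Ω = {(θ, x) : x ∈ X θ}`, with the σ-algebra induced by the product σ-algebra. -/
abbrev Omega : Type _ := {p : Θ × (G → S) // p.2 ∈ R.X p.1}

/-- The environment of a point of `Ω`. -/
def env (ω : R.Omega) : Θ := ω.1.1

/-- The configuration of a point of `Ω`. -/
def config (ω : R.Omega) : G → S := ω.1.2

/-- The diagonal action `g (θ, x) = (g θ, g x)` on `Ω`. -/
def act (g : G) (ω : R.Omega) : R.Omega :=
  ⟨(g • ω.1.1, shiftConfig g ω.1.2), by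
    rw [R.X_smul]; exact Set.mem_image_of_mem _ ω.2⟩

/-- The σ-algebra on `Ω` generated by the environment. -/
@[reducible] def envAlgebra : MeasurableSpace R.Omega := MeasurableSpace.comap R.env inferInstance

/-- The σ-algebra `ξ^B` on `Ω` generated by `(θ, x) ↦ x_B`. -/
@[reducible] def siteAlgebra (B : Set G) : MeasurableSpace R.Omega :=
  MeasurableSpace.comap (fun ω (k : B) => R.config ω k) inferInstance

theorem measurable_env : Measurable R.env := measurable_fst.comp measurable_subtype_coe

theorem measurable_config : Measurable R.config := measurable_snd.comp measurable_subtype_coe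

theorem envAlgebra_sup_siteAlgebra_le (B : Set G) :
    R.envAlgebra ⊔ R.siteAlgebra B ≤ (inferInstance : MeasurableSpace R.Omega) := by
  refine sup_le R.measurable_env.comap_le (Measurable.comap_le ?_)
  exact measurable_pi_lambda _ fun k => (measurable_pi_apply (k : G)).comp R.measurable_config

theorem act_inv_act (g : G) (ω : R.Omega) : R.act g⁻¹ (R.act g ω) = ω := by
  apply Subtype.ext
  refine Prod.ext (inv_smul_smul g _) ?_
  funext k
  simp [act, shiftConfig]

/-- The weak topological Markov property relative to `Θ`: the memory set `B` of `A` works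
simultaneously for all environments. -/
def RelativeWeakTMP : Prop :=
  ∀ A : Finset G, ∃ B : Finset G, A ⊆ B ∧
    ∀ θ : Θ, ∀ x ∈ R.X θ, ∀ x' ∈ R.X θ,
      (∀ k ∈ B, k ∉ A → x k = x' k) → patchConfig B (fun k => x k) x' ∈ R.X θ

end Basic

/-- A relative interaction: bounded functions `Φ_A : Ω → ℝ`, measurable with respect to the
environment and the sites of `A`, with `Φ_{gA}(θ, x) = Φ_A(g⁻¹ θ, g⁻¹ x)`. -/
structure Interaction {G Θ S : Type*} [Group G] [MulAction G Θ] [MeasurableSpace Θ]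
    [TopologicalSpace S] [MeasurableSpace S] (R : RelativeSystem G Θ S) where
  /-- The functions `Φ_A`. -/
  Φ : Finset G → R.Omega → ℝ
  bounded : ∀ A, ∃ C : ℝ, ∀ ω, |Φ A ω| ≤ C
  isLocal : ∀ A : Finset G, Measurable[R.envAlgebra ⊔ R.siteAlgebra (A : Set G)] (Φ A)
  symm : ∀ (g : G) (A : Finset G) (ω : R.Omega),
    Φ (A.map (mulLeftEmbedding g)) ω = Φ A (R.act g⁻¹ ω)

namespace Interaction

section Energy

variable {G Θ S : Type*} [Group G] [MulAction G Θ] [MeasurableSpace Θ]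
  [TopologicalSpace S] [MeasurableSpace S] {R : RelativeSystem G Θ S} (Φ : R.Interaction)

/-- The uniform norm of `Φ_A`. -/
noncomputable def unifNorm (A : Finset G) : ℝ := ⨆ ω : R.Omega, |Φ.Φ A ω|

/-- Absolute summability: `∑_{A ∋ 1} ‖Φ_A‖ < ∞`. -/
def AbsolutelySummable : Prop :=
  Summable (fun A : {A : Finset G // (1 : G) ∈ A} => Φ.unifNorm A.1)

/-- The energy content `E_A(θ, x) = ∑_{C ⊆ A} Φ_C(θ, x)`. -/
noncomputable def energy (A : Finset G) (ω : R.Omega) : ℝ := ∑ C ∈ A.powerset, Φ.Φ C ω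

open Classical in
/-- The conditional energy content `E_{A|B} = E_{A ∪ B} - E_B` for finite `B`. -/
noncomputable def condEnergyFinite (A B : Finset G) (ω : R.Omega) : ℝ :=
  Φ.energy (A ∪ B) ω - Φ.energy B ω

/-- The conditional energy content `E_{A|Aᶜ}(θ, x) = ∑_{C ∩ A ≠ ∅} Φ_C(θ, x)`. For an absolutely
summable interaction it is the limit of `E_{A|B \ A}` as the finite set `B` increases to `G`
(`tendsto_condEnergyFinite` below). -/
noncomputable def condEnergy (A : Finset G) (ω : R.Omega) : ℝ :=
  ∑' C : {C : Finset G // ∃ k ∈ C, k ∈ A}, Φ.Φ C.1 ω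

theorem abs_le_unifNorm (A : Finset G) (ω : R.Omega) : |Φ.Φ A ω| ≤ Φ.unifNorm A := by
  obtain ⟨C, hC⟩ := Φ.bounded A
  exact le_ciSup (f := fun ω => |Φ.Φ A ω|) ⟨C, by rintro _ ⟨ω, rfl⟩; exact hC ω⟩ ω

theorem unifNorm_nonneg (A : Finset G) : 0 ≤ Φ.unifNorm A :=
  Real.iSup_nonneg fun _ => abs_nonneg _

theorem unifNorm_map (g : G) (A : Finset G) :
    Φ.unifNorm (A.map (mulLeftEmbedding g)) = Φ.unifNorm A := by
  have hs : Function.Surjective (R.act g⁻¹) := fun ω => ⟨R.act g ω, R.act_inv_act g ω⟩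
  simp only [unifNorm, Φ.symm]
  exact hs.iSup_comp (fun ω => |Φ.Φ A ω|)

theorem summable_unifNorm_indicator (hΦ : Φ.AbsolutelySummable) (A : Finset G) :
    Summable ({C : Finset G | ∃ k ∈ C, k ∈ A}.indicator Φ.unifNorm) := by
  have h1 : ∀ g : G, Summable ({C : Finset G | g ∈ C}.indicator Φ.unifNorm) := by
    intro g
    have h0 : Summable ({C : Finset G | (1 : G) ∈ C}.indicator Φ.unifNorm) :=
      summable_subtype_iff_indicator.1 hΦ
    let e : Finset G → Finset G := fun C => C.map (mulLeftEmbedding g⁻¹)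
    have he : Function.Injective e := Finset.map_injective _
    refine (h0.comp_injective he).congr fun C => ?_
    have hm : (1 : G) ∈ e C ↔ g ∈ C := by
      simp [e, inv_mul_eq_one]
    by_cases hg : g ∈ C
    · rw [Function.comp_apply, Set.indicator_of_mem (by exact hm.2 hg),
        Set.indicator_of_mem (by exact hg)]
      exact Φ.unifNorm_map g⁻¹ C
    · rw [Function.comp_apply, Set.indicator_of_notMem (s := {C : Finset G | (1 : G) ∈ C})
          (fun h => hg (hm.1 h)),
        Set.indicator_of_notMem (by exact hg)]
  refine Summable.of_nonneg_of_le (fun C => Set.indicator_nonneg (fun C _ => Φ.unifNorm_nonneg C) C)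
    (fun C => ?_) (summable_sum (s := A) fun g _ => h1 g)
  have hnn : ∀ g ∈ A, 0 ≤ {C : Finset G | g ∈ C}.indicator Φ.unifNorm C :=
    fun g _ => Set.indicator_nonneg (fun C _ => Φ.unifNorm_nonneg C) C
  by_cases hC : ∃ k ∈ C, k ∈ A
  · obtain ⟨k, hk, hkA⟩ := hC
    rw [Set.indicator_of_mem (by exact ⟨k, hk, hkA⟩)]
    refine le_trans (le_of_eq ?_) (Finset.single_le_sum hnn hkA)
    rw [Set.indicator_of_mem (by exact hk)]
  · rw [Set.indicator_of_notMem (by exact hC)]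
    exact Finset.sum_nonneg hnn

/-- The series defining `E_{A|Aᶜ}` converges (absolutely). -/
theorem summable_condEnergy (hΦ : Φ.AbsolutelySummable) (A : Finset G) (ω : R.Omega) :
    Summable (fun C : {C : Finset G // ∃ k ∈ C, k ∈ A} => Φ.Φ C.1 ω) := by
  have h := summable_subtype_iff_indicator.2 (Φ.summable_unifNorm_indicator hΦ A)
  exact Summable.of_norm_bounded h fun C => Φ.abs_le_unifNorm C.1 ω

open Classical in
/-- `E_{A|Aᶜ}` is the limit of `E_{A|B \ A}` along the finite sets `B` directed by inclusion. -/
theorem tendsto_condEnergyFinite (hΦ : Φ.AbsolutelySummable) (A : Finset G) (ω : R.Omega) :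
    Tendsto (fun B : Finset G => Φ.condEnergyFinite A (B \ A) ω) atTop
      (𝓝 (Φ.condEnergy A ω)) := by
  have hS := (Φ.summable_condEnergy hΦ A ω).hasSum
  have hS' : HasSum ({C : Finset G | ∃ k ∈ C, k ∈ A}.indicator fun C => Φ.Φ C ω)
      (Φ.condEnergy A ω) := (hasSum_subtype_iff_indicator (f := fun C => Φ.Φ C ω)).1 hS
  have hp : Tendsto (fun B : Finset G => (A ∪ B).powerset) atTop atTop := by
    refine tendsto_atTop.2 fun T => ?_
    filter_upwards [eventually_ge_atTop (T.sup id)] with B hB C hC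
    exact Finset.mem_powerset.2
      (((Finset.le_sup (f := id) hC).trans hB).trans Finset.subset_union_right)
  refine (hS'.comp hp).congr fun B => ?_
  have hsub : (B \ A).powerset ⊆ (A ∪ B).powerset :=
    Finset.powerset_mono.2 (Finset.sdiff_subset.trans Finset.subset_union_right)
  have hU : A ∪ (B \ A) = A ∪ B := by simp
  simp only [condEnergyFinite, energy, hU, Function.comp_apply]
  rw [← Finset.sum_sdiff (f := fun C => Φ.Φ C ω) hsub, add_sub_cancel_right,
    ← Finset.sum_sdiff hsub, Finset.sum_eq_zero (s := (B \ A).powerset), add_zero]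
  · refine Finset.sum_congr rfl fun C hC => ?_
    simp only [Finset.mem_sdiff, Finset.mem_powerset] at hC
    rw [Set.indicator_of_mem]
    by_contra hcon
    refine hC.2 fun k hk => ?_
    refine Finset.mem_sdiff.2 ⟨?_, fun hkA => hcon ⟨k, hk, hkA⟩⟩
    rcases Finset.mem_union.1 (hC.1 hk) with h | h
    · exact absurd ⟨k, hk, h⟩ hcon
    · exact h
  · intro C hC
    rw [Set.indicator_of_notMem]
    rintro ⟨k, hk, hkA⟩
    exact (Finset.mem_sdiff.1 (Finset.mem_powerset.1 hC hk)).2 hkA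

end Energy

section Gibbs

variable {G Θ S : Type*} [Group G] [MulAction G Θ] [MeasurableSpace Θ]
  [Fintype S] [TopologicalSpace S] [MeasurableSpace S]
  {R : RelativeSystem G Θ S} (Φ : R.Interaction)

open Classical in
/-- The unnormalized Boltzmann weight of the pattern `u` on `A`, given `θ` and `x_{G \ A}`. -/
noncomputable def boltzmannWeight (A : Finset G) (ω : R.Omega) (u : A → S) : ℝ :=
  if h : patchConfig A u (R.config ω) ∈ R.X (R.env ω) then
    Real.exp (-Φ.condEnergy A ⟨(R.env ω, patchConfig A u (R.config ω)), h⟩)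
  else 0

open Classical in
/-- The partition function `Z_{A|Aᶜ}(θ, x)`. -/
noncomputable def partitionFunction (A : Finset G) (ω : R.Omega) : ℝ :=
  ∑ u : A → S, Φ.boltzmannWeight A ω u

/-- The Boltzmann distribution on the patterns on `A`, given `θ` and `x_{G \ A}`. -/
noncomputable def boltzmann (A : Finset G) (ω : R.Omega) (u : A → S) : ℝ :=
  Φ.boltzmannWeight A ω u / Φ.partitionFunction A ω

open Classical in
/-- The Gibbs kernel `K_A((θ, x), ·)`: the law of `(θ, u ∨ x_{G \ A})` for `u` distributed according
to the Boltzmann distribution given `θ` and `x_{G \ A}`. -/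
noncomputable def gibbsKernel (A : Finset G) (ω : R.Omega) : Measure R.Omega :=
  ∑ u : A → S,
    if h : patchConfig A u (R.config ω) ∈ R.X (R.env ω) then
      ENNReal.ofReal (Φ.boltzmann A ω u) •
        Measure.dirac (⟨(R.env ω, patchConfig A u (R.config ω)), h⟩ : R.Omega)
    else 0

theorem boltzmannWeight_nonneg (A : Finset G) (ω : R.Omega) (u : A → S) :
    0 ≤ Φ.boltzmannWeight A ω u := by
  unfold boltzmannWeight
  split_ifs
  · exact (Real.exp_pos _).le
  · exact le_rfl

theorem partitionFunction_pos (A : Finset G) (ω : R.Omega) : 0 < Φ.partitionFunction A ω := by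
  classical
  have hx : patchConfig A (fun k => R.config ω k) (R.config ω) = R.config ω := by
    funext k; simp [patchConfig]
  have hm : patchConfig A (fun k => R.config ω k) (R.config ω) ∈ R.X (R.env ω) := by
    rw [hx]; exact ω.2
  refine Finset.sum_pos' (fun u _ => Φ.boltzmannWeight_nonneg A ω u)
    ⟨fun k => R.config ω k, Finset.mem_univ _, ?_⟩
  rw [boltzmannWeight, dif_pos hm]
  exact Real.exp_pos _

/-- `K_A((θ, x), [u] ∩ W) = 1_W(θ, x) π(u)` for every pattern `u` on `A` and every `W` depending
only on the environment and the configuration off `A`. -/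
theorem gibbsKernel_cylinder_inter [MeasurableSingletonClass S] (A : Finset G) (ω : R.Omega)
    (u : A → S) (W : Set R.Omega)
    (hW : MeasurableSet[R.envAlgebra ⊔ R.siteAlgebra ((A : Set G)ᶜ)] W) :
    Φ.gibbsKernel A ω ({ω' | ∀ k : A, R.config ω' k = u k} ∩ W) =
      W.indicator (fun ω => ENNReal.ofReal (Φ.boltzmann A ω u)) ω := by
  classical
  have hWm : MeasurableSet W := R.envAlgebra_sup_siteAlgebra_le _ W hW
  have hcyl : MeasurableSet {ω' : R.Omega | ∀ k : A, R.config ω' k = u k} := by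
    rw [Set.ofPred_forall]
    exact MeasurableSet.iInter fun k =>
      ((measurable_pi_apply (k : G)).comp R.measurable_config) (measurableSet_singleton (u k))
  have hiff : ∀ ω₁ ω₂ : R.Omega, R.env ω₁ = R.env ω₂ →
      (∀ k ∉ A, R.config ω₁ k = R.config ω₂ k) → (ω₁ ∈ W ↔ ω₂ ∈ W) := by
    intro ω₁ ω₂ he hc
    rw [envAlgebra, siteAlgebra, ← MeasurableSpace.comap_prodMk] at hW
    obtain ⟨T, -, rfl⟩ := hW
    have hr : (fun k : ((A : Set G)ᶜ : Set G) => R.config ω₁ k) =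
        fun k : ((A : Set G)ᶜ : Set G) => R.config ω₂ k := by
      funext k
      exact hc k fun h => k.2 (Finset.mem_coe.2 h)
    simp only [Set.mem_preimage, he, hr]
  rw [gibbsKernel, Measure.finsetSum_apply, Finset.sum_eq_single u]
  · by_cases h : patchConfig A u (R.config ω) ∈ R.X (R.env ω)
    · have hu : (⟨(R.env ω, patchConfig A u (R.config ω)), h⟩ : R.Omega) ∈
          {ω' : R.Omega | ∀ k : A, R.config ω' k = u k} := by
        intro k
        simp [config, patchConfig]
      have hω := hiff ⟨(R.env ω, patchConfig A u (R.config ω)), h⟩ ω rfl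
        (fun k hk => by simp [config, patchConfig, hk])
      rw [dif_pos h, Measure.smul_apply, Measure.dirac_apply' _ (hcyl.inter hWm)]
      by_cases hw : ω ∈ W
      · rw [Set.indicator_of_mem (Set.mem_inter hu (hω.2 hw)), Set.indicator_of_mem hw]
        simp
      · rw [Set.indicator_of_notMem (fun hx => hw (hω.1 hx.2)), Set.indicator_of_notMem hw]
        simp
    · have h0 : Φ.boltzmann A ω u = 0 := by
        rw [boltzmann, boltzmannWeight, dif_neg h, zero_div]
      rw [dif_neg h]
      simp [Set.indicator, h0]
  · intro v _ hv
    by_cases h : patchConfig A v (R.config ω) ∈ R.X (R.env ω)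
    · rw [dif_pos h, Measure.smul_apply, Measure.dirac_apply' _ (hcyl.inter hWm),
        Set.indicator_of_notMem, smul_zero]
      intro hx
      apply hv
      funext k
      have hk := hx.1 k
      simpa [config, patchConfig] using hk
    · rw [dif_neg h]
      simp
  · simp

/-- A probability measure `μ` on `Ω` is a relative Gibbs measure for `Φ` if, for every finite `A`
and every measurable `W`, the conditional probability of `W` given the environment and the
configuration off `A` is `K_A(·, W)`, `μ`-almost surely. -/
def IsRelativeGibbs (μ : Measure R.Omega) : Prop :=
  IsProbabilityMeasure μ ∧
    ∀ (A : Finset G) (W : Set R.Omega), MeasurableSet W →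
      μ[W.indicator (fun _ => (1 : ℝ)) | R.envAlgebra ⊔ R.siteAlgebra ((A : Set G)ᶜ)]
        =ᵐ[μ] fun ω => (Φ.gibbsKernel A ω).real W

end Gibbs

end Interaction

end RelativeSystem

/-! The argument is the classical one for Gibbs measures: solve the problem in a large finite
volume, average over a Følner set, and take a weak limit. Write "resampling on A" for the map on
measures that replaces the pattern on A by a draw from the Boltzmann distribution. A measure on Ω
fixed by resampling on every finite A is a relative Gibbs measure
(`isRelativeGibbs_of_resample_eq`). Resampling on B and then on A ⊆ B is the same as resampling on B
(`resample_resample`), and resampling commutes with the group action (`resample_map_diagAct`).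

Start from any measure on Ω over ν, resample it on the union of the hBₙ for h in a Følner set Eₙ,
where the Bₙ exhaust G, and average the translates by h⁻¹. The result is fixed by resampling on
every A ⊆ Bₙ, lies over ν, and is nearly invariant. A weak limit should then have all the required
properties.

Two things stand in the way of the limit: Θ is only a Borel space, and the Boltzmann probabilities
contain the discontinuous constraint x ∈ X_θ. Both are met by choosing a good topology on Θ
(`exists_isAdapted`). The set of environments admitting a given finite pattern is a projection of a
Borel set, hence analytic, hence Borel up to a ν-null set. There are countably many such sets and
countably many local functions, so one topology makes these sets clopen, the local functions and the
action continuous, and ν tight. The weak Markov property says that inserting a pattern on A is legal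
as soon as the resulting pattern on a fixed finite B is admissible. Hence the Boltzmann
probabilities agree almost everywhere with continuous functions (`prob_eq_localProb`), and
invariance under resampling survives the limit. Closedness of X_θ ensures that the limit lives on Ω.
Tightness of ν and compactness of the configuration space give the limit itself. -/

/-! ### Analytic sets are universally measurable -/

section AnalyticMeasurable

open Set
open scoped ENNReal

/-- First half of the capacitability argument. Outer measure is continuous along increasing unions
of arbitrary sets, so the coordinates can be bounded one after another without the measure of the
image dropping to a. -/
theorem exists_truncation_bounds {α : Type*} [MeasurableSpace α] (μ : Measure α)
    (f : (ℕ → ℕ) → α) {a : ℝ≥0∞} (ha : a < μ (range f)) :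
    ∃ k : ℕ → ℕ, ∀ n, a < μ (f '' {x | ∀ i < n, x i ≤ k i}) := by
  have step : ∀ (n : ℕ) (D : {D : Set (ℕ → ℕ) // a < μ (f '' D)}),
      ∃ j : ℕ, a < μ (f '' (D.1 ∩ {x | x n ≤ j})) := by
    intro n D
    have hmono : Monotone fun j : ℕ => f '' (D.1 ∩ {x | x n ≤ j}) := fun i j hij =>
      image_mono (inter_subset_inter_right _ fun x (hx : x n ≤ i) => hx.trans hij)
    have hU : ⋃ j : ℕ, f '' (D.1 ∩ {x | x n ≤ j}) = f '' D.1 := by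
      rw [← image_iUnion, ← inter_iUnion]
      congr 1
      refine inter_eq_left.2 fun x _ => mem_iUnion.2 ⟨x n, le_refl (x n)⟩
    have h := D.2
    rw [← hU, hmono.measure_iUnion] at h
    exact lt_iSup_iff.1 h
  choose j hj using step
  let D : ℕ → {D : Set (ℕ → ℕ) // a < μ (f '' D)} := fun n =>
    Nat.rec ⟨univ, by rwa [image_univ]⟩ (fun n D => ⟨D.1 ∩ {x | x n ≤ j n D}, hj n D⟩) n
  refine ⟨fun n => j n (D n), fun n => ?_⟩
  have hD : ∀ n, (D n).1 = {x | ∀ i < n, x i ≤ j i (D i)} := by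
    intro n
    induction n with
    | zero => simp [D]
    | succ n ih =>
      have : (D (n + 1)).1 = (D n).1 ∩ {x | x n ≤ j n (D n)} := rfl
      rw [this, ih]
      ext x
      simp only [mem_inter_iff, mem_ofPred_eq, Nat.lt_succ_iff_lt_or_eq, or_imp, forall_and,
        forall_eq]
  rw [← hD n]
  exact (D n).2

theorem isCompact_setOf_forall_le (k : ℕ → ℕ) : IsCompact {x : ℕ → ℕ | ∀ i, x i ≤ k i} := by
  have : {x : ℕ → ℕ | ∀ i, x i ≤ k i} = Set.univ.pi fun i => Iic (k i) := by
    ext; simp [Pi.le_def]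
  rw [this]
  exact isCompact_univ_pi fun i => (finite_Iic (k i)).isCompact

/-- Second half of the capacitability argument: finitely many cylinders inside V cover the compact
box, and they only see coordinates below some n. -/
theorem exists_truncation_subset_of_isOpen (k : ℕ → ℕ) {V : Set (ℕ → ℕ)} (hV : IsOpen V)
    (hk : {x | ∀ i, x i ≤ k i} ⊆ V) : ∃ n, {x | ∀ i < n, x i ≤ k i} ⊆ V := by
  have hC := isCompact_setOf_forall_le k
  have hloc : ∀ x ∈ V, ∃ n, PiNat.cylinder x n ⊆ V := by
    intro x hx
    obtain ⟨_, ⟨y, n, rfl⟩, hxy, hsub⟩ :=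
      (PiNat.isTopologicalBasis_cylinders (fun _ => ℕ)).exists_subset_of_mem_open hx hV
    exact ⟨n, by rwa [PiNat.mem_cylinder_iff_eq.1 hxy]⟩
  choose! N hN using hloc
  obtain ⟨t, ht, hcov⟩ := hC.elim_nhds_subcover (fun x => PiNat.cylinder x (N x)) fun x _ =>
    (PiNat.isOpen_cylinder _ x (N x)).mem_nhds (PiNat.self_mem_cylinder x _)
  refine ⟨t.sup N, fun x hx => ?_⟩
  -- Replacing the tail of x by 0 moves it into the box without changing any coordinate seen by the
  -- cylinders.
  have hy : (fun i => if i < t.sup N then x i else 0) ∈ {x : ℕ → ℕ | ∀ i, x i ≤ k i} := by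
    intro i
    by_cases hi : i < t.sup N
    · simpa [hi] using hx i hi
    · simp [hi]
  obtain ⟨z, hz, hyz⟩ := mem_iUnion₂.1 (hcov hy)
  refine hN z (hk (ht z hz)) ?_
  rw [PiNat.mem_cylinder_iff] at hyz ⊢
  intro i hi
  rw [← hyz i hi, if_pos (hi.trans_le (Finset.le_sup hz))]

/-- Analytic sets are measurable up to null sets, for every finite Borel measure. -/
theorem MeasureTheory.AnalyticSet.nullMeasurableSet {α : Type*} [TopologicalSpace α]
    [TopologicalSpace.MetrizableSpace α] [MeasurableSpace α] [BorelSpace α] {s : Set α}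
    (hs : AnalyticSet s) (μ : Measure α) [IsFiniteMeasure μ] : NullMeasurableSet s μ := by
  rw [AnalyticSet] at hs
  obtain rfl | ⟨f, hf, rfl⟩ := hs
  · exact MeasurableSet.empty.nullMeasurableSet
  have key : ∀ a < μ (range f), ∃ K ⊆ range f, MeasurableSet K ∧ a ≤ μ K := by
    intro a ha
    obtain ⟨k, hk⟩ := exists_truncation_bounds μ f ha
    have hC := isCompact_setOf_forall_le k
    refine ⟨_, image_subset_range f _, (hC.image hf).measurableSet, ?_⟩
    -- Outer regularity: an open set around the compact image already contains the image of some
    -- truncation, whose measure exceeds a.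
    rw [(f '' {x : ℕ → ℕ | ∀ i, x i ≤ k i}).measure_eq_iInf_isOpen μ]
    refine le_iInf₂ fun U hU => le_iInf fun hUo => ?_
    obtain ⟨n, hn⟩ := exists_truncation_subset_of_isOpen k (hUo.preimage hf) (image_subset_iff.1 hU)
    exact (hk n).le.trans (measure_mono (image_subset_iff.2 hn))
  by_cases h0 : μ (range f) = 0
  · exact NullMeasurableSet.of_null h0
  obtain ⟨a, -, ha, hlim⟩ := exists_seq_strictMono_tendsto' (pos_iff_ne_zero.2 h0)
  choose K hKs hKm hKa using fun n => key (a n) (ha n).2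
  have hsub : (⋃ n, K n) ⊆ range f := iUnion_subset hKs
  have hm : MeasurableSet (⋃ n, K n) := MeasurableSet.iUnion hKm
  have hle : μ (range f) ≤ μ (⋃ n, K n) :=
    le_of_tendsto' hlim fun n => (hKa n).trans (measure_mono (subset_iUnion K n))
  exact hm.nullMeasurableSet.congr
    (ae_eq_of_subset_of_measure_ge hsub hle hm.nullMeasurableSet (measure_ne_top _ _))

/-- The projection of a measurable set of a product of standard Borel spaces is measurable up to
null sets. -/
theorem MeasurableSet.nullMeasurableSet_image_fst {Θ Y : Type*} [MeasurableSpace Θ]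
    [StandardBorelSpace Θ] [MeasurableSpace Y] [StandardBorelSpace Y] {s : Set (Θ × Y)}
    (hs : MeasurableSet s) (ν : Measure Θ) [IsFiniteMeasure ν] :
    NullMeasurableSet (Prod.fst '' s) ν := by
  let := upgradeStandardBorel Θ
  exact (hs.analyticSet_image measurable_fst).nullMeasurableSet ν

end AnalyticMeasurable

/-! ### Topologies that make a Borel action continuous -/

section EquivariantTopology

/-- On a standard Borel space with a measurable action of a countable group there is a second
countable metrizable topology, with the same Borel sets, for which the action and countably many
given measurable functions are continuous and all finite measures are tight. -/
theorem exists_topology_continuous_smul {G Θ I : Type*} [Group G] [Countable G]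
    [MeasurableSpace Θ] [StandardBorelSpace Θ] [MulAction G Θ] [MeasurableConstSMul G Θ]
    [Countable I] (φ : I → Θ → ℝ) (hφ : ∀ i, Measurable (φ i)) :
    ∃ _ : TopologicalSpace Θ, T2Space Θ ∧ TopologicalSpace.PseudoMetrizableSpace Θ ∧
      SecondCountableTopology Θ ∧ BorelSpace Θ ∧
      (∀ g : G, Continuous fun θ : Θ => g • θ) ∧ (∀ i, Continuous (φ i)) ∧
      ∀ ν : Measure Θ, IsFiniteMeasure ν → IsTightMeasureSet {ν} := by
  -- Recording the data along the whole orbit turns translation by g into the permutation h ↦ hg of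
  -- coordinates, which is continuous in the topology induced by `j`.
  let j : Θ → G → ℝ × (I → ℝ) := fun θ h => (embeddingReal Θ (h • θ), fun i => φ i (h • θ))
  have hjm : Measurable j := by
    refine measurable_pi_lambda _ fun h => ?_
    refine ((measurableEmbedding_embeddingReal Θ).measurable.comp
      (measurable_const_smul h)).prodMk (measurable_pi_lambda _ fun i => ?_)
    exact (hφ i).comp (measurable_const_smul h)
  have hji : Function.Injective j := by
    intro θ θ' h
    have h1 := congrArg Prod.fst (congrFun h 1)
    simpa [j] using (measurableEmbedding_embeddingReal Θ).injective h1
  -- Lusin–Souslin: an injective Borel map has Borel images. This gives both the equality of the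
  -- Borel structures and the tightness below.
  have hje : MeasurableEmbedding j := hjm.measurableEmbedding hji
  let τ : TopologicalSpace Θ := TopologicalSpace.induced j inferInstance
  have hind : IsInducing j := ⟨rfl⟩
  have hemb : IsEmbedding j := ⟨hind, hji⟩
  have hcoord : ∀ h : G, Continuous fun θ => j θ h := fun h =>
    (continuous_apply h).comp hind.continuous
  have hB : BorelSpace Θ := ⟨by
    rw [← hje.comap_eq, BorelSpace.measurable_eq (α := G → ℝ × (I → ℝ)), borel_comap]⟩
  have hT2 : T2Space Θ := hemb.t2Space
  refine ⟨τ, hT2, hind.pseudoMetrizableSpace, hemb.secondCountableTopology, hB, ?_, ?_, ?_⟩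
  · intro g
    refine hind.continuous_iff.2 (continuous_pi fun h => ?_)
    have : (fun θ => (j ∘ fun θ => g • θ) θ h) = fun θ => j θ (h * g) := by
      funext θ
      simp [j, mul_smul]
    rw [this]
    exact hcoord _
  · intro i
    have : φ i = fun θ => (j θ 1).2 i := by
      funext θ
      simp [j]
    rw [this]
    exact (continuous_apply i).comp (continuous_snd.comp (hcoord 1))
  · intro ν hν
    refine isTightMeasureSet_singleton_of_innerRegularWRT fun s hs r hr => ?_
    have hpre : j ⁻¹' (j '' s) = s := Set.preimage_image_eq s hji
    have hr' : r < ν.map j (j '' s) := by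
      rwa [Measure.map_apply hjm (hje.measurableSet_image.2 hs), hpre]
    -- The induced topology need not be shown Polish: the image of `s` is Borel in a Polish space,
    -- so compact sets inside it exhaust its measure, and they pull back to compact sets because
    -- they lie in the range of `j`.
    obtain ⟨K, hKs, hK, hKr⟩ := (hje.measurableSet_image.2 hs).exists_lt_isCompact hr'
    have hKr' : K ⊆ Set.range j := hKs.trans (Set.image_subset_range _ _)
    have hc : IsCompact (j ⁻¹' K) := hind.isCompact_preimage' hK hKr'
    refine ⟨j ⁻¹' K, ?_, ⟨hc, hc.isClosed⟩, ?_⟩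
    · rw [← hpre]
      exact Set.preimage_mono hKs
    · rwa [Measure.map_apply hjm hK.measurableSet] at hKr

end EquivariantTopology

/-! ### Inserting patterns and translating -/

namespace RelativeSystem

open scoped NNReal ENNReal

section Patch

variable {G Θ S : Type*}

/-- Replace the configuration on `A` by the pattern `u`. -/
noncomputable def patch (A : Finset G) (u : A → S) (p : Θ × (G → S)) : Θ × (G → S) :=
  (p.1, patchConfig A u p.2)

@[simp] theorem patch_fst (A : Finset G) (u : A → S) (p : Θ × (G → S)) :
    (patch A u p).1 = p.1 := rfl

theorem patch_snd_of_mem {A : Finset G} (u : A → S) (p : Θ × (G → S)) {k : G} (hk : k ∈ A) :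
    (patch A u p).2 k = u ⟨k, hk⟩ := by
  simp [patch, patchConfig, hk]

theorem patch_snd_of_notMem {A : Finset G} (u : A → S) (p : Θ × (G → S)) {k : G} (hk : k ∉ A) :
    (patch A u p).2 k = p.2 k := by
  simp [patch, patchConfig, hk]

@[simp] theorem patch_patch (A : Finset G) (u v : A → S) (p : Θ × (G → S)) :
    patch A u (patch A v p) = patch A u p := by
  refine Prod.ext rfl (funext fun k => ?_)
  by_cases hk : k ∈ A <;> simp [patch, patchConfig, hk]

theorem patch_self (A : Finset G) (p : Θ × (G → S)) : patch A (fun k => p.2 k) p = p := by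
  refine Prod.ext rfl (funext fun k => ?_)
  by_cases hk : k ∈ A <;> simp [patch, patchConfig, hk]

theorem measurable_patch [MeasurableSpace Θ] [MeasurableSpace S] (A : Finset G) (u : A → S) :
    Measurable (patch A u : Θ × (G → S) → _) := by
  refine measurable_fst.prodMk (measurable_pi_lambda _ fun k => ?_)
  by_cases hk : k ∈ A
  · simp only [patchConfig, hk, dif_pos]
    exact measurable_const
  · simp only [patchConfig, hk, dif_neg, not_false_eq_true]
    exact (measurable_pi_apply k).comp measurable_snd

theorem continuous_patch [TopologicalSpace Θ] [TopologicalSpace S] (A : Finset G) (u : A → S) :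
    Continuous (patch A u : Θ × (G → S) → _) := by
  refine continuous_fst.prodMk (continuous_pi fun k => ?_)
  by_cases hk : k ∈ A
  · simp only [patchConfig, hk, dif_pos]
    exact continuous_const
  · simp only [patchConfig, hk, dif_neg, not_false_eq_true]
    exact (continuous_apply k).comp continuous_snd

open Classical in
/-- Exchange the pattern on `A ⊆ B` inside a pattern on `B` with a pattern on `A`. -/
noncomputable def swapPattern {A B : Finset G} (hAB : A ⊆ B) (z : (B → S) × (A → S)) :
    (B → S) × (A → S) :=
  (fun k => if h : k.1 ∈ A then z.2 ⟨k, h⟩ else z.1 k, fun k => z.1 ⟨k, hAB k.2⟩)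

theorem swapPattern_involutive {A B : Finset G} (hAB : A ⊆ B) :
    Function.Involutive (swapPattern (S := S) hAB) := by
  intro z
  refine Prod.ext (funext fun k => ?_) (funext fun k => ?_)
  · by_cases hk : k.1 ∈ A <;> simp [swapPattern, hk]
  · simp [swapPattern]

theorem patch_swapPattern_fst {A B : Finset G} (hAB : A ⊆ B) (z : (B → S) × (A → S))
    (p : Θ × (G → S)) :
    patch B (swapPattern hAB z).1 p = patch A z.2 (patch B z.1 p) := by
  refine Prod.ext rfl (funext fun k => ?_)
  by_cases hk : k ∈ A
  · simp [patch, patchConfig, swapPattern, hk, hAB hk]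
  · by_cases hk' : k ∈ B <;> simp [patch, patchConfig, swapPattern, hk, hk']

theorem patch_swapPattern_snd {A B : Finset G} (hAB : A ⊆ B) (z : (B → S) × (A → S))
    (p : Θ × (G → S)) :
    patch A (swapPattern hAB z).2 (patch B (swapPattern hAB z).1 p) = patch B z.1 p := by
  rw [← patch_swapPattern_fst hAB, swapPattern_involutive hAB z]

variable [Group G] [MulAction G Θ]

/-- The diagonal action on pairs of environments and configurations. -/
def diagAct (g : G) (p : Θ × (G → S)) : Θ × (G → S) := (g • p.1, shiftConfig g p.2)

theorem diagAct_mul (g h : G) (p : Θ × (G → S)) :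
    diagAct (g * h) p = diagAct g (diagAct h p) := by
  refine Prod.ext (mul_smul _ _ _) (funext fun k => ?_)
  simp [diagAct, shiftConfig, mul_assoc]

theorem measurable_diagAct [MeasurableSpace Θ] [MeasurableSpace S] [MeasurableConstSMul G Θ]
    (g : G) : Measurable (diagAct g : Θ × (G → S) → _) :=
  ((measurable_const_smul g).comp measurable_fst).prodMk
    (measurable_pi_lambda _ fun k => (measurable_pi_apply (g⁻¹ * k)).comp measurable_snd)

theorem continuous_diagAct [TopologicalSpace Θ] [TopologicalSpace S] (g : G)
    (hg : Continuous fun θ : Θ => g • θ) : Continuous (diagAct g : Θ × (G → S) → _) :=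
  (hg.comp continuous_fst).prodMk
    (continuous_pi fun k => (continuous_apply (g⁻¹ * k)).comp continuous_snd)

/-- Translation of a finite set, as a bijection. -/
def translateEquiv (g : G) (A : Finset G) : A ≃ (A.map (mulLeftEmbedding g) : Finset G) where
  toFun k := ⟨g * k, Finset.mem_map_of_mem (mulLeftEmbedding g) k.2⟩
  invFun k := ⟨g⁻¹ * k, by
    obtain ⟨l, hl, h⟩ := Finset.mem_map.1 k.2
    rw [← h]
    simpa using hl⟩
  left_inv k := by simp
  right_inv k := by simp

theorem mem_map_mulLeft {g : G} {A : Finset G} {k : G} :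
    k ∈ A.map (mulLeftEmbedding g) ↔ g⁻¹ * k ∈ A := by
  rw [Finset.mem_map]
  constructor
  · rintro ⟨l, hl, rfl⟩
    simpa using hl
  · intro h
    exact ⟨_, h, by simp⟩

theorem patch_map_diagAct (g : G) (A : Finset G) (u : A → S) (p : Θ × (G → S)) :
    patch (A.map (mulLeftEmbedding g)) (fun k => u ((translateEquiv g A).symm k)) (diagAct g p) =
      diagAct g (patch A u p) := by
  refine Prod.ext rfl (funext fun k => ?_)
  by_cases hk : g⁻¹ * k ∈ A
  · have hk' : k ∈ A.map (mulLeftEmbedding g) := mem_map_mulLeft.2 hk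
    rw [patch_snd_of_mem _ _ hk']
    simp [diagAct, shiftConfig, patch, patchConfig, hk, translateEquiv]
  · have hk' : k ∉ A.map (mulLeftEmbedding g) := fun h => hk (mem_map_mulLeft.1 h)
    rw [patch_snd_of_notMem _ _ hk']
    simp [diagAct, shiftConfig, patch, patchConfig, hk]

end Patch

/-! ### The Gibbs specification as resampling of measures -/

namespace Interaction

section Specification

variable {G Θ S : Type*} [Group G] [MulAction G Θ] [MeasurableSpace Θ]
  [TopologicalSpace S] [MeasurableSpace S] {R : RelativeSystem G Θ S}

/-- Functions of the environment and of the pattern on `A`, defined everywhere, that represent the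
interaction on `Ω`. -/
structure LocalRep (Φ : R.Interaction) where
  /-- The representing functions. -/
  f : (A : Finset G) → Θ × (A → S) → ℝ
  measurable_f : ∀ A, Measurable (f A)
  abs_le : ∀ A y, |f A y| ≤ Φ.unifNorm A
  eq_f : ∀ A ω, Φ.Φ A ω = f A (R.env ω, fun k => R.config ω k)

/-- The factorization through the environment and the pattern is arbitrary off Ω. Truncating it at
the uniform norm keeps the energy series uniformly convergent on the whole product. -/
theorem nonempty_localRep (Φ : R.Interaction) : Nonempty Φ.LocalRep := by
  have h : ∀ A : Finset G, ∃ f : Θ × (A → S) → ℝ, Measurable f ∧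
      ∀ ω, Φ.Φ A ω = f (R.env ω, fun k => R.config ω k) := by
    intro A
    have hA := Φ.isLocal A
    rw [envAlgebra, siteAlgebra, ← MeasurableSpace.comap_prodMk] at hA
    obtain ⟨f, hf, h⟩ := hA.exists_eq_measurable_comp
    exact ⟨f, hf, fun ω => congrFun h ω⟩
  choose f hf hfΦ using h
  refine ⟨⟨fun A y => max (-Φ.unifNorm A) (min (f A y) (Φ.unifNorm A)),
    fun A => measurable_const.max ((hf A).min measurable_const), fun A y => ?_, fun A ω => ?_⟩⟩
  · have := Φ.unifNorm_nonneg A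
    exact abs_le.2 ⟨le_max_left _ _, max_le (by linarith) (min_le_right _ _)⟩
  · have := abs_le.1 (Φ.abs_le_unifNorm A ω)
    rw [← hfΦ, min_eq_left this.2, max_eq_right this.1]

namespace LocalRep

variable {Φ : R.Interaction} (F : Φ.LocalRep)

/-- The local function of `C`, as a function on all pairs. -/
def term (C : Finset G) (p : Θ × (G → S)) : ℝ := F.f C (p.1, fun k => p.2 k)

theorem measurable_term (C : Finset G) : Measurable (F.term C) :=
  (F.measurable_f C).comp (measurable_fst.prodMk
    (measurable_pi_lambda _ fun k => (measurable_pi_apply (k : G)).comp measurable_snd))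

/-- The conditional energy, as a function on all pairs. -/
noncomputable def condEnergy (A : Finset G) (p : Θ × (G → S)) : ℝ :=
  ∑' C : {C : Finset G // ∃ k ∈ C, k ∈ A}, F.term C.1 p

theorem summable_term (hΦ : Φ.AbsolutelySummable) (A : Finset G) (p : Θ × (G → S)) :
    Summable (fun C : {C : Finset G // ∃ k ∈ C, k ∈ A} => F.term C.1 p) :=
  Summable.of_norm_bounded
    (summable_subtype_iff_indicator.2 (Φ.summable_unifNorm_indicator hΦ A))
    fun C => F.abs_le C.1 _

theorem measurable_condEnergy [Countable G] (hΦ : Φ.AbsolutelySummable) (A : Finset G) :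
    Measurable (F.condEnergy A) :=
  measurable_of_tendsto_metrizable'
    (f := fun (s : Finset {C : Finset G // ∃ k ∈ C, k ∈ A}) p => ∑ C ∈ s, F.term C.1 p) atTop
    (fun s => Finset.measurable_fun_sum s fun C _ => F.measurable_term C.1)
    (tendsto_pi_nhds.2 fun p => (F.summable_term hΦ A p).hasSum)

theorem condEnergy_coe (A : Finset G) (ω : R.Omega) :
    F.condEnergy A ω.1 = Φ.condEnergy A ω :=
  tsum_congr fun C => (F.eq_f C.1 ω).symm

theorem abs_condEnergy_le (hΦ : Φ.AbsolutelySummable) (A : Finset G) (p : Θ × (G → S)) :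
    |F.condEnergy A p| ≤ ∑' C : {C : Finset G // ∃ k ∈ C, k ∈ A}, Φ.unifNorm C.1 :=
  tsum_of_norm_bounded (f := fun C : {C : Finset G // ∃ k ∈ C, k ∈ A} => F.term C.1 p)
    (summable_subtype_iff_indicator.2 (Φ.summable_unifNorm_indicator hΦ A)).hasSum
    fun C => F.abs_le C.1 _

theorem term_patch {A C : Finset G} (h : ¬ ∃ k ∈ C, k ∈ A) (u : A → S) (p : Θ × (G → S)) :
    F.term C (patch A u p) = F.term C p := by
  unfold term
  congr 2
  funext k
  exact patch_snd_of_notMem u p fun hk => h ⟨k, k.2, hk⟩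

/-- Changing the pattern on A changes only the terms that meet A, and these are counted in both
energies. The identity is stated additively so that it exponentiates to `weight_detailedBalance`. -/
theorem condEnergy_add_condEnergy_patch (hΦ : Φ.AbsolutelySummable) {A B : Finset G}
    (hAB : A ⊆ B) (u : A → S) (p : Θ × (G → S)) :
    F.condEnergy B (patch A u p) + F.condEnergy A p =
      F.condEnergy B p + F.condEnergy A (patch A u p) := by
  have key : F.condEnergy B (patch A u p) - F.condEnergy B p =
      F.condEnergy A (patch A u p) - F.condEnergy A p := by
    unfold condEnergy
    rw [← (F.summable_term hΦ B _).tsum_sub (F.summable_term hΦ B _),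
      ← (F.summable_term hΦ A _).tsum_sub (F.summable_term hΦ A _)]
    have hB := tsum_subtype {C : Finset G | ∃ k ∈ C, k ∈ B}
      fun C => F.term C (patch A u p) - F.term C p
    have hA := tsum_subtype {C : Finset G | ∃ k ∈ C, k ∈ A}
      fun C => F.term C (patch A u p) - F.term C p
    refine hB.trans (Eq.trans (tsum_congr fun C => ?_) hA.symm)
    by_cases hC : ∃ k ∈ C, k ∈ A
    · obtain ⟨k, hk, hkA⟩ := hC
      rw [Set.indicator_of_mem (by exact ⟨k, hk, hAB hkA⟩),
        Set.indicator_of_mem (by exact ⟨k, hk, hkA⟩)]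
    · rw [Set.indicator_of_notMem (s := {C : Finset G | ∃ k ∈ C, k ∈ A}) hC]
      refine Set.indicator_apply_eq_zero.2 fun _ => ?_
      rw [F.term_patch hC, sub_self]
  linarith

open Classical in
/-- The Boltzmann weight of a configuration: `e^{-E_A}` on `Ω` and zero elsewhere. -/
noncomputable def weight (A : Finset G) (p : Θ × (G → S)) : ℝ≥0 :=
  if p.2 ∈ R.X p.1 then (Real.exp (-F.condEnergy A p)).toNNReal else 0

theorem weight_of_mem (A : Finset G) {p : Θ × (G → S)} (hp : p.2 ∈ R.X p.1) :
    F.weight A p = (Real.exp (-F.condEnergy A p)).toNNReal := if_pos hp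

theorem weight_of_notMem (A : Finset G) {p : Θ × (G → S)} (hp : p.2 ∉ R.X p.1) :
    F.weight A p = 0 := if_neg hp

theorem weight_ne_zero {A : Finset G} {p : Θ × (G → S)} : F.weight A p ≠ 0 ↔ p.2 ∈ R.X p.1 := by
  refine ⟨fun h => not_not.1 fun hp => h (F.weight_of_notMem A hp), fun h => ?_⟩
  rw [F.weight_of_mem A h]
  exact (Real.toNNReal_pos.2 (Real.exp_pos _)).ne'

theorem measurable_weight [Countable G] (hΦ : Φ.AbsolutelySummable) (A : Finset G) :
    Measurable (F.weight A) := by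
  refine Measurable.ite R.measurableSet_total ?_ measurable_const
  exact (Real.measurable_exp.comp (F.measurable_condEnergy hΦ A).neg).real_toNNReal

theorem weight_detailedBalance (hΦ : Φ.AbsolutelySummable) {A B : Finset G} (hAB : A ⊆ B)
    (u : A → S) (p : Θ × (G → S)) :
    F.weight B (patch A u p) * F.weight A p = F.weight B p * F.weight A (patch A u p) := by
  by_cases h : p.2 ∈ R.X p.1
  · by_cases h' : (patch A u p).2 ∈ R.X (patch A u p).1
    · simp only [F.weight_of_mem _ h, F.weight_of_mem _ h',
        ← Real.toNNReal_mul (Real.exp_pos _).le, ← Real.exp_add]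
      congr 2
      linarith [F.condEnergy_add_condEnergy_patch hΦ hAB u p]
    · rw [F.weight_of_notMem B h', F.weight_of_notMem A h', zero_mul, mul_zero]
  · rw [F.weight_of_notMem B h, F.weight_of_notMem A h, zero_mul, mul_zero]

/-- The representing functions are equivariant only on Ω, but off Ω both weights vanish. On Ω the
energy series is reindexed by C ↦ gC. -/
theorem weight_map_diagAct (g : G) (A : Finset G) (p : Θ × (G → S)) :
    F.weight (A.map (mulLeftEmbedding g)) (diagAct g p) = F.weight A p := by
  have hiff : (diagAct g p).2 ∈ R.X (diagAct g p).1 ↔ p.2 ∈ R.X p.1 := by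
    change shiftConfig g p.2 ∈ R.X (g • p.1) ↔ _
    rw [R.X_smul]
    refine ⟨?_, Set.mem_image_of_mem _⟩
    rintro ⟨x, hx, h⟩
    have : x = p.2 := by
      funext k
      have := congrFun h (g * k)
      simpa [shiftConfig] using this
    rwa [← this]
  by_cases h : p.2 ∈ R.X p.1
  · rw [F.weight_of_mem _ h, F.weight_of_mem _ (hiff.2 h)]
    have hmem : ∀ C : Finset G, (∃ k ∈ C, k ∈ A) ↔
        ∃ k ∈ (Equiv.mulLeft g).finsetCongr C, k ∈ A.map (mulLeftEmbedding g) := by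
      intro C
      constructor
      · rintro ⟨k, hk, hkA⟩
        exact ⟨g * k, by simpa using hk, by simpa using hkA⟩
      · rintro ⟨k, hk, hkA⟩
        refine ⟨g⁻¹ * k, ?_, mem_map_mulLeft.1 hkA⟩
        obtain ⟨l, hl, rfl⟩ := Finset.mem_map.1 hk
        simpa using hl
    have hE : F.condEnergy (A.map (mulLeftEmbedding g)) (diagAct g p) = F.condEnergy A p := by
      refine (F.condEnergy_coe (A.map (mulLeftEmbedding g)) (R.act g ⟨p, h⟩)).trans
        (Eq.trans ?_ (F.condEnergy_coe A ⟨p, h⟩).symm)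
      unfold Interaction.condEnergy
      rw [← (Equiv.subtypeEquiv (Equiv.mulLeft g).finsetCongr hmem).tsum_eq]
      refine tsum_congr fun C => ?_
      have h2 := Φ.symm g C.1 (R.act g ⟨p, h⟩)
      rwa [R.act_inv_act] at h2
    rw [hE]
  · rw [F.weight_of_notMem _ h, F.weight_of_notMem _ (mt hiff.1 h)]

variable [Fintype S]

open Classical in
/-- The normalization of the Boltzmann weights on `A`. -/
noncomputable def partition (A : Finset G) (p : Θ × (G → S)) : ℝ≥0 :=
  ∑ u : A → S, F.weight A (patch A u p)

/-- The conditional probability of the pattern `u` on `A`. -/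
noncomputable def prob (A : Finset G) (u : A → S) (p : Θ × (G → S)) : ℝ≥0 :=
  F.weight A (patch A u p) / F.partition A p

theorem partition_patch (A : Finset G) (u : A → S) (p : Θ × (G → S)) :
    F.partition A (patch A u p) = F.partition A p := by
  simp [partition]

theorem weight_le_partition (A : Finset G) (p : Θ × (G → S)) : F.weight A p ≤ F.partition A p := by
  classical
  have h := Finset.single_le_sum (f := fun u : A → S => F.weight A (patch A u p))
    (fun _ _ => zero_le) (Finset.mem_univ fun k : A => p.2 k)
  rwa [patch_self] at h

theorem partition_ne_zero (A : Finset G) {p : Θ × (G → S)} (hp : p.2 ∈ R.X p.1) :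
    F.partition A p ≠ 0 := fun h =>
  (F.weight_ne_zero (A := A)).2 hp (le_antisymm (h ▸ F.weight_le_partition A p) zero_le)

open Classical in
theorem sum_prob (A : Finset G) {p : Θ × (G → S)} (hp : p.2 ∈ R.X p.1) :
    ∑ u : A → S, F.prob A u p = 1 := by
  unfold prob
  rw [← Finset.sum_div]
  exact div_self (F.partition_ne_zero A hp)

theorem measurable_partition [Countable G] (hΦ : Φ.AbsolutelySummable) (A : Finset G) :
    Measurable (F.partition A) :=
  Finset.measurable_fun_sum _ fun u _ => (F.measurable_weight hΦ A).comp (measurable_patch A u)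

theorem measurable_prob [Countable G] (hΦ : Φ.AbsolutelySummable) (A : Finset G) (u : A → S) :
    Measurable (F.prob A u) :=
  ((F.measurable_weight hΦ A).comp (measurable_patch A u)).div (F.measurable_partition hΦ A)

open Classical in
-- Consistency of the specification, by reversibility: draw v on B, then u on A. Detailed balance
-- makes the joint law invariant under exchanging the configurations before and after the second
-- draw, so both have the same law.
theorem sum_prob_mul_sum_prob (hΦ : Φ.AbsolutelySummable) {A B : Finset G} (hAB : A ⊆ B)
    (p : Θ × (G → S)) (g : Θ × (G → S) → ℝ≥0∞) :
    ∑ v : B → S, (F.prob B v p : ℝ≥0∞) *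
        ∑ u : A → S, (F.prob A u (patch B v p) : ℝ≥0∞) * g (patch A u (patch B v p)) =
      ∑ v : B → S, (F.prob B v p : ℝ≥0∞) * g (patch B v p) := by
  let h : (B → S) × (A → S) → ℝ≥0 := fun z => F.prob B z.1 p * F.prob A z.2 (patch B z.1 p)
  have hswap : ∀ z, h (swapPattern hAB z) = h z := by
    intro z
    simp only [h, prob]
    rw [patch_swapPattern_snd, patch_swapPattern_fst, partition_patch, div_mul_div_comm,
      div_mul_div_comm, F.weight_detailedBalance hΦ hAB]
  have hsum : ∀ v : B → S, ∑ u : A → S, h (v, u) = F.prob B v p := by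
    intro v
    simp only [h]
    rw [← Finset.mul_sum]
    -- Off Ω the probabilities on A need not sum to 1, but then the prefactor vanishes.
    by_cases hv : (patch B v p).2 ∈ R.X (patch B v p).1
    · rw [F.sum_prob A hv, mul_one]
    · rw [prob, not_not.1 (mt F.weight_ne_zero.1 hv), zero_div, zero_mul]
  calc _ = ∑ z : (B → S) × (A → S), (h z : ℝ≥0∞) * g (patch A z.2 (patch B z.1 p)) := by
        rw [Fintype.sum_prod_type]
        refine Finset.sum_congr rfl fun v _ => ?_
        rw [Finset.mul_sum]
        refine Finset.sum_congr rfl fun u _ => ?_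
        simp only [h, ENNReal.coe_mul, mul_assoc]
    _ = ∑ z : (B → S) × (A → S), (h z : ℝ≥0∞) * g (patch B z.1 p) := by
        refine Fintype.sum_equiv (swapPattern_involutive (S := S) hAB).toPerm _ _ fun z => ?_
        simp only [Function.Involutive.coe_toPerm]
        rw [hswap, patch_swapPattern_fst]
    _ = _ := by
        rw [Fintype.sum_prod_type]
        refine Finset.sum_congr rfl fun v _ => ?_
        simp only
        rw [← Finset.sum_mul, ← hsum v, ENNReal.ofNNReal_finsetSum]

open Classical in
/-- Resample the pattern on `A` from the Boltzmann distribution. -/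
noncomputable def resample (A : Finset G) (m : Measure (Θ × (G → S))) : Measure (Θ × (G → S)) :=
  ∑ u : A → S, (m.withDensity fun p => (F.prob A u p : ℝ≥0∞)).map (patch A u)

theorem prob_map_diagAct (g : G) (A : Finset G) (u : A → S) (p : Θ × (G → S)) :
    F.prob (A.map (mulLeftEmbedding g)) (fun k => u ((translateEquiv g A).symm k)) (diagAct g p) =
      F.prob A u p := by
  classical
  have hZ : F.partition (A.map (mulLeftEmbedding g)) (diagAct g p) = F.partition A p := by
    unfold partition
    symm
    refine Fintype.sum_equiv (Equiv.arrowCongr (translateEquiv g A) (Equiv.refl S)) _ _ fun u => ?_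
    rw [← F.weight_map_diagAct g A, ← patch_map_diagAct]
    rfl
  rw [prob, prob, hZ, patch_map_diagAct, weight_map_diagAct]

variable [Countable G]

open Classical in
theorem lintegral_resample (hΦ : Φ.AbsolutelySummable) (A : Finset G)
    (m : Measure (Θ × (G → S))) {g : Θ × (G → S) → ℝ≥0∞} (hg : Measurable g) :
    ∫⁻ p, g p ∂(F.resample A m) =
      ∫⁻ p, ∑ u : A → S, (F.prob A u p : ℝ≥0∞) * g (patch A u p) ∂m := by
  have hm : ∀ u : A → S, Measurable fun p => (F.prob A u p : ℝ≥0∞) := fun u =>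
    (F.measurable_prob hΦ A u).coe_nnreal_ennreal
  have hgm : ∀ u : A → S, Measurable fun p => g (patch A u p) := fun u =>
    hg.comp (measurable_patch A u)
  rw [resample, lintegral_finsetSum_measure,
    lintegral_finsetSum (f := fun u p => (F.prob A u p : ℝ≥0∞) * g (patch A u p)) _
      fun u _ => (hm u).mul (hgm u)]
  refine Finset.sum_congr rfl fun u _ => ?_
  rw [lintegral_map hg (measurable_patch A u), 
    lintegral_withDensity_eq_lintegral_mul _ (hm u) (hgm u)]
  rfl

/-- One resampling on a large set thus yields invariance on all of its subsets at once. -/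
theorem resample_resample (hΦ : Φ.AbsolutelySummable) {A B : Finset G} (hAB : A ⊆ B)
    (m : Measure (Θ × (G → S))) : F.resample A (F.resample B m) = F.resample B m := by
  classical
  refine Measure.ext_of_lintegral _ fun g hg => ?_
  rw [F.lintegral_resample hΦ A _ hg, F.lintegral_resample hΦ B _ hg, F.lintegral_resample hΦ B]
  · exact lintegral_congr fun p => F.sum_prob_mul_sum_prob hΦ hAB p g
  · exact Finset.measurable_fun_sum _ fun u _ =>
      (F.measurable_prob hΦ A u).coe_nnreal_ennreal.mul (hg.comp (measurable_patch A u))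

/-- Resampling preserves measures on `Ω` and their marginals on the environments. -/
theorem map_fst_resample (hΦ : Φ.AbsolutelySummable) (A : Finset G) {m : Measure (Θ × (G → S))}
    (hm : ∀ᵐ p ∂m, p.2 ∈ R.X p.1) : (F.resample A m).map Prod.fst = m.map Prod.fst := by
  classical
  refine Measure.ext_of_lintegral _ fun g hg => ?_
  rw [lintegral_map hg measurable_fst, lintegral_map hg measurable_fst,
    F.lintegral_resample (g := fun p => g p.1) hΦ A m (hg.comp measurable_fst)]
  refine lintegral_congr_ae ?_
  filter_upwards [hm] with p hp
  simp only [patch_fst]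
  rw [← Finset.sum_mul, ← ENNReal.ofNNReal_finsetSum, F.sum_prob A hp, ENNReal.coe_one, one_mul]

theorem ae_mem_resample (hΦ : Φ.AbsolutelySummable) (A : Finset G) (m : Measure (Θ × (G → S))) :
    ∀ᵐ p ∂(F.resample A m), p.2 ∈ R.X p.1 := by
  classical
  have hs : MeasurableSet {p : Θ × (G → S) | p.2 ∈ R.X p.1}ᶜ := R.measurableSet_total.compl
  change F.resample A m {p : Θ × (G → S) | p.2 ∈ R.X p.1}ᶜ = 0
  rw [← lintegral_indicator_one hs, F.lintegral_resample hΦ A m (measurable_one.indicator hs)]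
  refine (lintegral_congr fun p => ?_).trans lintegral_zero
  refine Finset.sum_eq_zero fun u _ => ?_
  by_cases h : (patch A u p).2 ∈ R.X (patch A u p).1
  · rw [Set.indicator_of_notMem (s := {p : Θ × (G → S) | p.2 ∈ R.X p.1}ᶜ) (fun hx => hx h), mul_zero]
  · rw [prob, not_not.1 (mt F.weight_ne_zero.1 h), zero_div, ENNReal.coe_zero, zero_mul]

theorem resample_map_diagAct [MeasurableConstSMul G Θ] (hΦ : Φ.AbsolutelySummable) (g : G)
    (A : Finset G) (m : Measure (Θ × (G → S))) :
    F.resample (A.map (mulLeftEmbedding g)) (m.map (diagAct g)) =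
      (F.resample A m).map (diagAct g) := by
  classical
  refine Measure.ext_of_lintegral _ fun h hh => ?_
  rw [lintegral_map hh (measurable_diagAct g), F.lintegral_resample hΦ _ _ hh,
    F.lintegral_resample (g := fun p => h (diagAct g p)) hΦ _ _ (hh.comp (measurable_diagAct g)),
    lintegral_map _ (measurable_diagAct g)]
  · refine lintegral_congr fun p => ?_
    symm
    refine Fintype.sum_equiv (Equiv.arrowCongr (translateEquiv g A) (Equiv.refl S)) _ _ fun u => ?_
    rw [← patch_map_diagAct, ← F.prob_map_diagAct g A u p]
    rfl
  · exact Finset.measurable_fun_sum _ fun u _ =>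
      (F.measurable_prob hΦ _ u).coe_nnreal_ennreal.mul (hh.comp (measurable_patch _ u))

open Classical in
theorem integral_resample (hΦ : Φ.AbsolutelySummable) (A : Finset G)
    (m : Measure (Θ × (G → S))) [IsFiniteMeasure m] {h : Θ × (G → S) → ℝ} (hh : Measurable h)
    {c : ℝ} (hc : ∀ p, |h p| ≤ c) :
    ∫ p, h p ∂(F.resample A m) = ∫ p, ∑ u : A → S, F.prob A u p * h (patch A u p) ∂m := by
  have hm : ∀ u : A → S, Measurable (F.prob A u) := F.measurable_prob hΦ A
  have hle : ∀ (u : A → S) p, F.prob A u p ≤ 1 := fun u p => by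
    refine div_le_one_of_le₀ ?_ zero_le
    exact Finset.single_le_sum (f := fun u : A → S => F.weight A (patch A u p))
      (fun _ _ => zero_le) (Finset.mem_univ u)
  have hfin : ∀ u : A → S, IsFiniteMeasure (m.withDensity fun p => (F.prob A u p : ℝ≥0∞)) :=
    fun u => isFiniteMeasure_withDensity <| by
      refine ((lintegral_mono fun p => ENNReal.coe_le_one_iff.2 (hle u p)).trans_lt ?_).ne
      simp
  have hbd : ∀ u : A → S, Integrable (fun p => (F.prob A u p : ℝ) * h (patch A u p)) m := by
    intro u
    refine Integrable.of_bound (C := c) ?_ (Eventually.of_forall fun p => ?_)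
    · exact ((hm u).coe_nnreal_real.mul (hh.comp (measurable_patch A u))).aestronglyMeasurable
    · rw [Real.norm_eq_abs, abs_mul, NNReal.abs_eq]
      have h1 : (F.prob A u p : ℝ) ≤ 1 := by exact_mod_cast hle u p
      have h2 := hc (patch A u p)
      nlinarith [abs_nonneg (h (patch A u p)), (F.prob A u p).coe_nonneg]
  rw [resample, integral_finsetSum_measure fun u _ => ?_, integral_finsetSum _ fun u _ => hbd u]
  · refine Finset.sum_congr rfl fun u _ => ?_
    rw [integral_map (measurable_patch A u).aemeasurable hh.aestronglyMeasurable,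
      integral_withDensity_eq_integral_smul (hm u)]
    rfl
  · exact Integrable.of_bound hh.aestronglyMeasurable c (Eventually.of_forall hc)

end LocalRep

end Specification

end Interaction

end RelativeSystem

/-! ### Weak compactness over a fixed tight marginal -/

section Compactness

open BoundedContinuousFunction

/-- Probability measures on a product with a compact space that have a given tight marginal
converge weakly along an ultrafilter. -/
theorem exists_tendsto_integral_of_map_fst_eq {Θ X : Type*} [TopologicalSpace Θ] [T2Space Θ]
    [TopologicalSpace.PseudoMetrizableSpace Θ] [SecondCountableTopology Θ] [MeasurableSpace Θ]
    [BorelSpace Θ] [TopologicalSpace X] [CompactSpace X] [T2Space X] [SecondCountableTopology X]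
    [MeasurableSpace X] [BorelSpace X] (ν : Measure Θ) [IsFiniteMeasure ν]
    (hν : IsTightMeasureSet {ν}) (m : ℕ → Measure (Θ × X)) (hm : ∀ n, IsProbabilityMeasure (m n))
    (hfst : ∀ n, (m n).map Prod.fst = ν) :
    ∃ (𝒰 : Ultrafilter ℕ) (m' : Measure (Θ × X)), (𝒰 : Filter ℕ) ≤ atTop ∧
      IsProbabilityMeasure m' ∧ m'.map Prod.fst = ν ∧
      ∀ f : Θ × X → ℝ, Continuous f → (∃ c, ∀ p, |f p| ≤ c) →
        Tendsto (fun n => ∫ p, f p ∂(m n)) 𝒰 (𝓝 (∫ p, f p ∂m')) := by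
  let P : ℕ → ProbabilityMeasure (Θ × X) := fun n => ⟨m n, hm n⟩
  have htight : IsTightMeasureSet {((μ : ProbabilityMeasure (Θ × X)) : Measure (Θ × X)) |
      μ ∈ Set.range P} := by
    rw [isTightMeasureSet_iff_exists_isCompact_measure_compl_le] at hν ⊢
    intro ε hε
    obtain ⟨K, hK, hKε⟩ := hν ε hε
    -- The mass off K × X depends only on the common marginal, so a single K serves all n.
    refine ⟨K ×ˢ Set.univ, hK.prod isCompact_univ, ?_⟩
    rintro _ ⟨_, ⟨n, rfl⟩, rfl⟩
    have h : (K ×ˢ (Set.univ : Set X))ᶜ = Prod.fst ⁻¹' Kᶜ := by ext; simp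
    change m n _ ≤ ε
    rw [h, ← Measure.map_apply measurable_fst hK.measurableSet.compl, hfst n]
    exact hKε ν rfl
  obtain ⟨m', -, hm'⟩ := (isCompact_closure_of_isTightMeasureSet htight).ultrafilter_le_nhds
    ((hyperfilter ℕ).map P) (le_principal_iff.2 (Ultrafilter.mem_map.2
      (univ_mem' fun n => subset_closure (Set.mem_range_self n))))
  have hlim : Tendsto P (hyperfilter ℕ) (𝓝 m') := hm'
  rw [ProbabilityMeasure.tendsto_iff_forall_integral_tendsto] at hlim
  have hlim' : ∀ f : Θ × X → ℝ, Continuous f → (∃ c, ∀ p, |f p| ≤ c) →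
      Tendsto (fun n => ∫ p, f p ∂(m n)) (hyperfilter ℕ : Filter ℕ)
        (𝓝 (∫ p, f p ∂(m' : Measure (Θ × X)))) := by
    rintro f hf ⟨c, hc⟩
    exact hlim (BoundedContinuousFunction.ofNormedAddCommGroup f hf c hc)
  refine ⟨hyperfilter ℕ, m', Nat.hyperfilter_le_atTop, m'.2, ?_, hlim'⟩
  have : IsFiniteMeasure ((m' : Measure (Θ × X)).map Prod.fst) :=
    Measure.isFiniteMeasure_map _ _
  refine ext_of_forall_integral_eq_of_IsFiniteMeasure fun f => ?_
  have h := hlim' (fun p => f p.1) (f.continuous.comp continuous_fst)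
    ⟨‖f‖, fun p => f.norm_coe_le_norm p.1⟩
  have hf := f.continuous.measurable.aestronglyMeasurable (μ := ν)
  have hmap : ∀ m : Measure (Θ × X), ∫ θ, f θ ∂(m.map Prod.fst) = ∫ p, f p.1 ∂m := fun m =>
    integral_map measurable_fst.aemeasurable f.continuous.measurable.aestronglyMeasurable
  rw [hmap]
  refine tendsto_nhds_unique h (tendsto_const_nhds.congr fun n => ?_)
  rw [← hmap, hfst n]

end Compactness

/-! ### Invariance under resampling implies the Gibbs property -/

namespace RelativeSystem

namespace Interaction

open scoped NNReal ENNReal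

section GibbsOfResample

variable {G Θ S : Type*} [Group G] [MulAction G Θ] [MeasurableSpace Θ]
  [TopologicalSpace S] [MeasurableSpace S]
  {R : RelativeSystem G Θ S} {Φ : R.Interaction} (F : Φ.LocalRep)

namespace LocalRep

theorem boltzmannWeight_eq (A : Finset G) (ω : R.Omega) (u : A → S) :
    Φ.boltzmannWeight A ω u = F.weight A (patch A u ω.1) := by
  unfold boltzmannWeight
  split_ifs with h
  · rw [F.weight_of_mem A (p := patch A u ω.1) h, Real.coe_toNNReal _ (Real.exp_pos _).le]
    rw [← F.condEnergy_coe]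
    rfl
  · rw [F.weight_of_notMem A (p := patch A u ω.1) h, NNReal.coe_zero]

/-- Functions that ignore the configuration on `A` are measurable with respect to the environment
and the configuration off `A`. -/
theorem measurable_of_patch_invariant [Nonempty S] (A : Finset G) {f : Θ × (G → S) → ℝ}
    (hf : Measurable f) (hinv : ∀ (u : A → S) p, f (patch A u p) = f p) :
    Measurable[R.envAlgebra ⊔ R.siteAlgebra ((A : Set G)ᶜ)] fun ω : R.Omega => f ω.1 := by
  classical
  let s : S := Classical.arbitrary S
  -- Filling A with a fixed letter does not affect `f`, and exhibits it as a function of the data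
  -- off A.
  let e : Θ × (((A : Set G)ᶜ : Set G) → S) → Θ × (G → S) := fun q =>
    (q.1, fun k => if h : k ∈ (A : Set G)ᶜ then q.2 ⟨k, h⟩ else s)
  have he : Measurable e := by
    refine measurable_fst.prodMk (measurable_pi_lambda _ fun k => ?_)
    by_cases hk : k ∈ (A : Set G)ᶜ
    · simp only [hk, dif_pos]
      exact (measurable_pi_apply _).comp measurable_snd
    · simp only [hk, dif_neg, not_false_eq_true]
      exact measurable_const
  rw [envAlgebra, siteAlgebra, ← MeasurableSpace.comap_prodMk]
  have : (fun ω : R.Omega => f ω.1) = (f ∘ e) ∘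
      fun ω => (R.env ω, fun k : ((A : Set G)ᶜ : Set G) => R.config ω k) := by
    funext ω
    rw [← hinv (fun _ => s) ω.1]
    refine congrArg f (Prod.ext rfl (funext fun k => ?_))
    by_cases hk : k ∈ A
    · rw [patch_snd_of_mem _ _ hk]
      simp [e, hk]
    · rw [patch_snd_of_notMem _ _ hk]
      simp [e, hk, config]
  rw [this]
  exact (hf.comp he).comp (comap_measurable _)

variable [Fintype S]

theorem boltzmann_eq (A : Finset G) (ω : R.Omega) (u : A → S) :
    Φ.boltzmann A ω u = F.prob A u ω.1 := by
  rw [boltzmann, partitionFunction, prob, NNReal.coe_div, partition, NNReal.coe_sum]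
  simp only [F.boltzmannWeight_eq]

open Classical in
theorem gibbsKernel_real (A : Finset G) (ω : R.Omega) {W : Set R.Omega} (hW : MeasurableSet W) :
    (Φ.gibbsKernel A ω).real W =
      ∑ u : A → S, F.prob A u ω.1 * (Subtype.val '' W).indicator (fun _ => (1 : ℝ))
        (patch A u ω.1) := by
  have h : Φ.gibbsKernel A ω W = ∑ u : A → S, (F.prob A u ω.1 : ℝ≥0∞) *
      (Subtype.val '' W).indicator (fun _ => (1 : ℝ≥0∞)) (patch A u ω.1) := by
    rw [gibbsKernel, Measure.finsetSum_apply]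
    refine Finset.sum_congr rfl fun u _ => ?_
    split_ifs with h
    · rw [Measure.smul_apply, Measure.dirac_apply' _ hW, F.boltzmann_eq,
        ENNReal.ofReal_coe_nnreal, smul_eq_mul]
      congr 1
      refine Set.indicator_const_eq_indicator_const ?_
      constructor
      · exact fun hx => ⟨_, hx, rfl⟩
      · rintro ⟨ω', hω', he⟩
        have : ω' = ⟨_, h⟩ := Subtype.ext he
        exact this ▸ hω'
    · have h0 : F.prob A u ω.1 = 0 := by
        rw [prob, F.weight_of_notMem A (p := patch A u ω.1) h, zero_div]
      rw [h0]
      simp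
  rw [Measure.real, h, ENNReal.toReal_sum]
  · refine Finset.sum_congr rfl fun u _ => ?_
    by_cases hu : patch A u ω.1 ∈ Subtype.val '' W
    · simp [Set.indicator_of_mem hu]
    · simp [Set.indicator_of_notMem hu]
  · intro u _
    by_cases hu : patch A u ω.1 ∈ Subtype.val '' W
    · simp [Set.indicator_of_mem hu]
    · simp [Set.indicator_of_notMem hu]

theorem prob_patch (A : Finset G) (u v : A → S) (p : Θ × (G → S)) :
    F.prob A u (patch A v p) = F.prob A u p := by
  rw [prob, prob, partition_patch, patch_patch]

/-- A probability measure on `Ω` that is invariant under resampling is a relative Gibbs measure. -/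
theorem isRelativeGibbs_of_resample_eq [Countable G] (hΦ : Φ.AbsolutelySummable)
    (μ : Measure R.Omega) [IsProbabilityMeasure μ]
    (hres : ∀ A, F.resample A (μ.map Subtype.val) = μ.map Subtype.val) :
    Φ.IsRelativeGibbs μ := by
  classical
  refine ⟨inferInstance, fun A W hW => ?_⟩
  obtain ⟨ω₀⟩ : Nonempty R.Omega := nonempty_of_isProbabilityMeasure μ
  have : Nonempty S := ⟨R.config ω₀ 1⟩
  have hval : MeasurableEmbedding (Subtype.val : R.Omega → Θ × (G → S)) :=
    MeasurableEmbedding.subtype_coe R.measurableSet_total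
  have : IsProbabilityMeasure (μ.map Subtype.val) :=
    Measure.isProbabilityMeasure_map hval.measurable.aemeasurable
  have hW' : MeasurableSet (Subtype.val '' W) := hval.measurableSet_image.2 hW
  let f : Θ × (G → S) → ℝ := fun p => ∑ u : A → S, F.prob A u p *
    (Subtype.val '' W).indicator (fun _ => (1 : ℝ)) (patch A u p)
  have hf : Measurable f := Finset.measurable_fun_sum _ fun u _ =>
    (F.measurable_prob hΦ A u).coe_nnreal_real.mul
      ((measurable_const.indicator hW').comp (measurable_patch A u))
  have hfinv : ∀ (u : A → S) p, f (patch A u p) = f p := fun u p => by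
    simp only [f, prob_patch, patch_patch]
  have hker : (fun ω => (Φ.gibbsKernel A ω).real W) = fun ω : R.Omega => f ω.1 :=
    funext fun ω => F.gibbsKernel_real A ω hW
  have hfbd : ∀ ω : R.Omega, ‖f ω.1‖ ≤ 1 := by
    intro ω
    have h0 : 0 ≤ f ω.1 := Finset.sum_nonneg fun u _ =>
      mul_nonneg (F.prob A u ω.1).coe_nonneg (Set.indicator_nonneg (fun _ _ => zero_le_one) _)
    rw [Real.norm_eq_abs, abs_of_nonneg h0]
    have h1 : (∑ u : A → S, (F.prob A u ω.1 : ℝ)) = 1 := by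
      rw [← NNReal.coe_sum, F.sum_prob A ω.2, NNReal.coe_one]
    rw [← h1]
    refine Finset.sum_le_sum fun u _ => mul_le_of_le_one_right (F.prob A u ω.1).coe_nonneg ?_
    exact Set.indicator_le_self' (fun _ _ => zero_le_one) _
  have hfint : Integrable (fun ω : R.Omega => f ω.1) μ :=
    Integrable.of_bound (hf.comp hval.measurable).aestronglyMeasurable 1
      (Eventually.of_forall hfbd)
  rw [hker]
  symm
  refine ae_eq_condExp_of_forall_setIntegral_eq (R.envAlgebra_sup_siteAlgebra_le _)
    ((integrable_const (1 : ℝ)).indicator hW) (fun _ _ _ => hfint.integrableOn) ?_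
    (measurable_of_patch_invariant A hf hfinv).stronglyMeasurable.aestronglyMeasurable
  intro V hV _
  rw [envAlgebra, siteAlgebra, ← MeasurableSpace.comap_prodMk] at hV
  obtain ⟨T, hT, rfl⟩ := hV
  let r : Θ × (G → S) → Θ × (((A : Set G)ᶜ : Set G) → S) := fun p => (p.1, fun k => p.2 k)
  have hr : Measurable r := measurable_fst.prodMk
    (measurable_pi_lambda _ fun k => (measurable_pi_apply (k : G)).comp measurable_snd)
  have hrinv : ∀ (u : A → S) p, r (patch A u p) = r p := fun u p =>
    Prod.ext rfl (funext fun k => patch_snd_of_notMem u p fun h => k.2 (Finset.mem_coe.2 h))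
  have hpre : (fun ω => (R.env ω, fun k : ((A : Set G)ᶜ : Set G) => R.config ω k)) ⁻¹' T =
      (Subtype.val ⁻¹' (r ⁻¹' T) : Set R.Omega) := rfl
  have hVm : MeasurableSet (r ⁻¹' T) := hr hT
  rw [hpre, ← hval.setIntegral_map, setIntegral_indicator hW, setIntegral_const, smul_eq_mul,
    mul_one, ← integral_indicator hVm]
  have hWV : MeasurableSet (r ⁻¹' T ∩ Subtype.val '' W) := hVm.inter hW'
  -- Resampling on A does not move points in or out of an event determined off A, so its indicator
  -- passes inside the sum. The integral over that event then becomes the resampled mass of its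
  -- intersection with W.
  have h1 : ∀ p, (r ⁻¹' T).indicator f p = ∑ u : A → S, F.prob A u p *
      (r ⁻¹' T ∩ Subtype.val '' W).indicator (fun _ => (1 : ℝ)) (patch A u p) := by
    intro p
    have hmem : ∀ u : A → S, patch A u p ∈ r ⁻¹' T ↔ p ∈ r ⁻¹' T := fun u => by
      rw [Set.mem_preimage, hrinv, Set.mem_preimage]
    by_cases hp : p ∈ r ⁻¹' T
    · rw [Set.indicator_of_mem hp]
      refine Finset.sum_congr rfl fun u _ => ?_
      congr 1
      exact Set.indicator_const_eq_indicator_const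
        ⟨fun h => ⟨(hmem u).2 hp, h⟩, fun h => h.2⟩
    · rw [Set.indicator_of_notMem hp]
      refine (Finset.sum_eq_zero fun u _ => ?_).symm
      rw [Set.indicator_of_notMem (fun h => hp ((hmem u).1 h.1)), mul_zero]
  rw [integral_congr_ae (Eventually.of_forall h1), ← F.integral_resample hΦ A _
    (measurable_const.indicator hWV) (c := 1) (fun p => ?_), hres A,
    integral_indicator_const _ hWV, smul_eq_mul, mul_one, Measure.real,
    Measure.map_apply hval.measurable hWV, Set.preimage_inter, Set.preimage_image_eq _
      hval.injective, Measure.real]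
  rw [abs_of_nonneg (Set.indicator_nonneg (fun _ _ => zero_le_one) _)]
  exact Set.indicator_le_self' (fun _ _ => zero_le_one) _

end LocalRep

end GibbsOfResample

end Interaction

end RelativeSystem

/-! ### Adapted topologies and continuous Boltzmann probabilities -/

namespace RelativeSystem

theorem isProbabilityMeasure_of_map_fst {Θ Y : Type*} [MeasurableSpace Θ] [MeasurableSpace Y]
    {ν : Measure Θ} [IsProbabilityMeasure ν]
    {m : Measure (Θ × Y)} (hm : m.map Prod.fst = ν) : IsProbabilityMeasure m := by
  constructor
  rw [← Set.preimage_univ (f := Prod.fst), ← Measure.map_apply measurable_fst MeasurableSet.univ,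
    hm, measure_univ]

theorem ae_of_map_fst {Θ Y : Type*} [MeasurableSpace Θ] [MeasurableSpace Y] {ν : Measure Θ}
    {m : Measure (Θ × Y)}
    (hm : m.map Prod.fst = ν) {P : Θ → Prop} (hP : ∀ᵐ θ ∂ν, P θ) : ∀ᵐ p ∂m, P p.1 := by
  rw [← hm] at hP
  exact ae_of_ae_map measurable_fst.aemeasurable hP

theorem exists_finset_exhaustion (G : Type*) [Countable G] :
    ∃ B : ℕ → Finset G, ∀ A : Finset G, ∀ᶠ n in atTop, A ⊆ B n := by
  classical
  obtain h | h := isEmpty_or_nonempty G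
  · exact ⟨fun _ => ∅, fun A => Eventually.of_forall fun n k => (h.false k).elim⟩
  obtain ⟨e, he⟩ := exists_surjective_nat G
  refine ⟨fun n => (Finset.range n).image e, fun A => ?_⟩
  have : ∀ k ∈ A, ∀ᶠ n in atTop, k ∈ (Finset.range n).image e := by
    intro k _
    obtain ⟨i, rfl⟩ := he k
    filter_upwards [eventually_gt_atTop i] with n hn
    exact Finset.mem_image_of_mem e (Finset.mem_range.2 hn)
  exact (eventually_all_finset A).2 this

/-- The patterns on a finite set form a discrete space, so continuity may be tested with the pattern
held fixed. -/
theorem continuous_of_pattern {G Θ S Y : Type*} [TopologicalSpace Θ] [TopologicalSpace S]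
    [DiscreteTopology S] [TopologicalSpace Y] (A : Finset G) {g : (A → S) → Θ → Y}
    (hg : ∀ w, Continuous (g w)) :
    Continuous fun p : Θ × (G → S) => g (fun k => p.2 k) p.1 := by
  have h : Continuous fun q : Θ × (A → S) => g q.2 q.1 := continuous_prod_of_discrete_right.2 hg
  have hr : Continuous fun p : Θ × (G → S) => (p.1, fun k : A => p.2 k) :=
    continuous_fst.prodMk (continuous_pi fun k => (continuous_apply (k : G)).comp continuous_snd)
  exact h.comp hr

/-- A point belongs to a closed set of configurations as soon as all its finite patterns occur. -/
theorem mem_of_forall_pattern {G Θ S : Type*} [Group G] [MulAction G Θ] [MeasurableSpace Θ]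
    [TopologicalSpace S] [MeasurableSpace S] (R : RelativeSystem G Θ S) {θ : Θ} {x : G → S}
    (h : ∀ A : Finset G, ∃ y ∈ R.X θ, ∀ k : A, y k = x k) : x ∈ R.X θ := by
  choose y hy hyx using h
  refine (R.isClosed_X θ).mem_of_tendsto (b := (atTop : Filter (Finset G)))
    (tendsto_pi_nhds.2 fun k => ?_) (Eventually.of_forall hy)
  refine tendsto_const_nhds.congr' ?_
  filter_upwards [eventually_ge_atTop {k}] with A hA
  exact (hyx A ⟨k, hA (Finset.mem_singleton_self k)⟩).symm

namespace Interaction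

namespace LocalRep

open scoped NNReal ENNReal

section Adapted

variable {G Θ S : Type*} [Group G] [MulAction G Θ] [MeasurableSpace Θ]
  [TopologicalSpace S] [MeasurableSpace S] {R : RelativeSystem G Θ S} {Φ : R.Interaction}

/-- A topology on the environments is adapted to the interaction if the local functions are
continuous and if, up to a null set, the environments that admit a given finite pattern form a
clopen set. -/
structure IsAdapted [TopologicalSpace Θ] (F : Φ.LocalRep) (ν : Measure Θ)
    (W : (A : Finset G) → (A → S) → Set Θ) : Prop where
  continuous_f : ∀ A w, Continuous fun θ => F.f A (θ, w)
  isClopen : ∀ A w, IsClopen (W A w)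
  ae_mem_iff : ∀ᵐ θ ∂ν, ∀ A w, θ ∈ W A w ↔ ∃ x ∈ R.X θ, ∀ k : A, x k = w k

/-- Adapted topologies exist. -/
theorem exists_isAdapted [Countable G] [StandardBorelSpace Θ] [MeasurableConstSMul G Θ]
    [Fintype S] [DiscreteTopology S] [MeasurableSingletonClass S] (F : Φ.LocalRep)
    (ν : Measure Θ) [IsFiniteMeasure ν] :
    ∃ (_ : TopologicalSpace Θ) (W : (A : Finset G) → (A → S) → Set Θ), T2Space Θ ∧
      TopologicalSpace.PseudoMetrizableSpace Θ ∧ SecondCountableTopology Θ ∧ BorelSpace Θ ∧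
      (∀ g : G, Continuous fun θ : Θ => g • θ) ∧ IsTightMeasureSet {ν} ∧ F.IsAdapted ν W := by
  have hnull : ∀ (A : Finset G) (w : A → S),
      NullMeasurableSet {θ | ∃ x ∈ R.X θ, ∀ k : A, x k = w k} ν := by
    intro A w
    have hm : MeasurableSet {p : Θ × (G → S) | p.2 ∈ R.X p.1 ∧ ∀ k : A, p.2 k = w k} := by
      have hw : MeasurableSet {p : Θ × (G → S) | ∀ k : A, p.2 k = w k} := by
        rw [Set.ofPred_forall]
        refine MeasurableSet.iInter fun k => ?_
        have hk : Measurable fun p : Θ × (G → S) => p.2 k :=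
          (measurable_pi_apply (k : G)).comp measurable_snd
        exact hk (measurableSet_singleton (w k))
      exact R.measurableSet_total.inter hw
    convert hm.nullMeasurableSet_image_fst ν using 1
    ext θ
    constructor
    · rintro ⟨x, hx, hw⟩
      exact ⟨(θ, x), ⟨hx, hw⟩, rfl⟩
    · rintro ⟨⟨_, x⟩, ⟨hx, hw⟩, rfl⟩
      exact ⟨x, hx, hw⟩
  choose W hWm hW using fun (A : Finset G) (w : A → S) => (hnull A w).exists_measurable_superset_ae_eq
  -- This index set is countable, so one topology handles all patterns, and the exceptional null
  -- sets can be united.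
  let I := Σ A : Finset G, A → S
  let φ : I ⊕ I → Θ → ℝ := Sum.elim (fun i θ => F.f i.1 (θ, i.2))
    fun i => (W i.1 i.2).indicator fun _ => 1
  have hφ : ∀ i, Measurable (φ i) := by
    rintro (i | i)
    · exact (F.measurable_f i.1).comp (measurable_id.prodMk measurable_const)
    · exact measurable_const.indicator (hW i.1 i.2).1
  obtain ⟨τ, h1, h2, h3, h4, h5, h6, h7⟩ := exists_topology_continuous_smul (G := G) φ hφ
  refine ⟨τ, W, h1, h2, h3, h4, h5, h7 ν inferInstance, fun A w => h6 (Sum.inl ⟨A, w⟩),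
    fun A w => ?_, ?_⟩
  · have hc : Continuous ((W A w).indicator fun _ => (1 : ℝ)) := h6 (Sum.inr ⟨A, w⟩)
    have e1 : W A w = (W A w).indicator (fun _ => (1 : ℝ)) ⁻¹' {1} := by
      ext θ; by_cases h : θ ∈ W A w <;> simp [h]
    have e2 : W A w = (W A w).indicator (fun _ => (1 : ℝ)) ⁻¹' Set.Ioi 0 := by
      ext θ; by_cases h : θ ∈ W A w <;> simp [h]
    refine ⟨?_, ?_⟩
    · rw [e1]; exact isClosed_singleton.preimage hc
    · rw [e2]; exact isOpen_Ioi.preimage hc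
  · rw [ae_all_iff]
    intro A
    rw [ae_all_iff]
    intro w
    filter_upwards [(hW A w).2] with θ hθ
    exact iff_of_eq hθ

/-- The pairs whose configuration has an admissible pattern on `A`. -/
def admissible (W : (A : Finset G) → (A → S) → Set Θ) (A : Finset G) : Set (Θ × (G → S)) :=
  {p | p.1 ∈ W A fun k => p.2 k}

theorem isClopen_admissible [TopologicalSpace Θ] [DiscreteTopology S] {F : Φ.LocalRep}
    {ν : Measure Θ} {W : (A : Finset G) → (A → S) → Set Θ} (hW : F.IsAdapted ν W) (A : Finset G) :
    IsClopen (admissible W A) := by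
  have hc : Continuous fun p : Θ × (G → S) =>
      (W A fun k => p.2 k).indicator (fun _ => (1 : ℝ)) p.1 :=
    continuous_of_pattern A fun w => continuous_const.indicator fun θ hθ => by
      rw [(hW.isClopen A w).frontier_eq] at hθ
      exact hθ.elim
  have e1 : admissible W A = (fun p : Θ × (G → S) =>
      (W A fun k => p.2 k).indicator (fun _ => (1 : ℝ)) p.1) ⁻¹' {1} := by
    ext p; by_cases h : p.1 ∈ W A fun k => p.2 k <;> simp [admissible, h]
  have e2 : admissible W A = (fun p : Θ × (G → S) =>
      (W A fun k => p.2 k).indicator (fun _ => (1 : ℝ)) p.1) ⁻¹' Set.Ioi 0 := by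
    ext p; by_cases h : p.1 ∈ W A fun k => p.2 k <;> simp [admissible, h]
  refine ⟨?_, ?_⟩
  · rw [e1]; exact isClosed_singleton.preimage hc
  · rw [e2]; exact isOpen_Ioi.preimage hc

theorem continuous_indicator_admissible [TopologicalSpace Θ] [DiscreteTopology S] {F : Φ.LocalRep}
    {ν : Measure Θ} {W : (A : Finset G) → (A → S) → Set Θ} (hW : F.IsAdapted ν W) (A : Finset G) :
    Continuous ((admissible W A).indicator fun _ => (1 : ℝ)) :=
  continuous_const.indicator fun _ hp => by
    rw [(isClopen_admissible hW A).frontier_eq] at hp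
    exact hp.elim

theorem continuous_condEnergy [TopologicalSpace Θ] [DiscreteTopology S] {F : Φ.LocalRep}
    {ν : Measure Θ} {W : (A : Finset G) → (A → S) → Set Θ} (hW : F.IsAdapted ν W)
    (hΦ : Φ.AbsolutelySummable) (A : Finset G) : Continuous (F.condEnergy A) :=
  continuous_tsum (f := fun (C : {C : Finset G // ∃ k ∈ C, k ∈ A}) p => F.term C.1 p)
    (fun C => continuous_of_pattern (g := fun w θ => F.f C.1 (θ, w)) C.1
      (hW.continuous_f C.1))
    (summable_subtype_iff_indicator.2 (Φ.summable_unifNorm_indicator hΦ A))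
    fun C _ => F.abs_le C.1 _

/-- Under the weak topological Markov property, whether a pattern on `A` may be inserted is decided
by the pattern on the memory set of `A`. -/
theorem patch_mem_iff_admissible {W : (A : Finset G) → (A → S) → Set Θ}
    {A B : Finset G} (hAB : A ⊆ B)
    (hB : ∀ θ : Θ, ∀ x ∈ R.X θ, ∀ x' ∈ R.X θ,
      (∀ k ∈ B, k ∉ A → x k = x' k) → patchConfig B (fun k => x k) x' ∈ R.X θ)
    {p : Θ × (G → S)} (hp : p.2 ∈ R.X p.1)
    (hpW : ∀ A w, p.1 ∈ W A w ↔ ∃ x ∈ R.X p.1, ∀ k : A, x k = w k) (u : A → S) :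
    (patch A u p).2 ∈ R.X (patch A u p).1 ↔ patch A u p ∈ admissible W B := by
  have h : patch A u p ∈ admissible W B ↔
      ∃ x ∈ R.X p.1, ∀ k : B, x k = (patch A u p).2 k := hpW B _
  rw [h]
  refine ⟨fun hu => ⟨_, hu, fun _ => rfl⟩, ?_⟩
  rintro ⟨x, hx, hxu⟩
  -- The witness `x` and the original configuration agree on B \ A, because patching only affected
  -- A. Gluing them gives exactly the patched configuration.
  have hmem := hB p.1 x hx p.2 hp fun k hkB hkA => by
    rw [hxu ⟨k, hkB⟩, patch_snd_of_notMem u p hkA]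
  have he : (patch A u p).2 = patchConfig B (fun k => x k) p.2 := by
    funext k
    by_cases hkB : k ∈ B
    · rw [← hxu ⟨k, hkB⟩]
      simp [patchConfig, hkB]
    · rw [patch_snd_of_notMem u p fun hk => hkB (hAB hk)]
      simp [patchConfig, hkB]
  rw [he]
  exact hmem

/-- The Boltzmann weight with the constraint imposed on the pattern on `B` only. -/
noncomputable def localWeight (F : Φ.LocalRep) (W : (A : Finset G) → (A → S) → Set Θ)
    (A B : Finset G) (p : Θ × (G → S)) : ℝ :=
  (admissible W B).indicator (fun _ => (1 : ℝ)) p * Real.exp (-F.condEnergy A p)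

theorem localWeight_nonneg (F : Φ.LocalRep) (W : (A : Finset G) → (A → S) → Set Θ)
    (A B : Finset G) (p : Θ × (G → S)) : 0 ≤ F.localWeight W A B p :=
  mul_nonneg (Set.indicator_nonneg (fun _ _ => zero_le_one) _) (Real.exp_pos _).le

variable [Fintype S]

open Classical in
/-- The Boltzmann probabilities with the constraint imposed on the pattern on `B` only, with the
normalization bounded below by the least possible weight. -/
noncomputable def localProb (F : Φ.LocalRep) (W : (A : Finset G) → (A → S) → Set Θ)
    (A B : Finset G) (u : A → S) (p : Θ × (G → S)) : ℝ :=
  F.localWeight W A B (patch A u p) /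
    max (∑ v : A → S, F.localWeight W A B (patch A v p))
      (Real.exp (-∑' C : {C : Finset G // ∃ k ∈ C, k ∈ A}, Φ.unifNorm C.1))

theorem continuous_localProb [TopologicalSpace Θ] [DiscreteTopology S] {F : Φ.LocalRep}
    {ν : Measure Θ} {W : (A : Finset G) → (A → S) → Set Θ} (hW : F.IsAdapted ν W)
    (hΦ : Φ.AbsolutelySummable) (A B : Finset G) (u : A → S) :
    Continuous (F.localProb W A B u) := by
  have hw : Continuous (F.localWeight W A B) :=
    (continuous_indicator_admissible hW B).mul
      (Real.continuous_exp.comp (continuous_condEnergy hW hΦ A).neg)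
  refine (hw.comp (continuous_patch A u)).div ?_ fun p =>
    (lt_max_of_lt_right (Real.exp_pos _)).ne'
  exact (continuous_finsetSum _ fun v _ => hw.comp (continuous_patch A v)).max continuous_const

theorem abs_localProb_le (F : Φ.LocalRep) (W : (A : Finset G) → (A → S) → Set Θ)
    (A B : Finset G) (u : A → S) (p : Θ × (G → S)) : |F.localProb W A B u p| ≤ 1 := by
  classical
  have h0 := F.localWeight_nonneg W A B (patch A u p)
  have hpos := lt_max_of_lt_right (b := ∑ v : A → S, F.localWeight W A B (patch A v p))
    (Real.exp_pos (-∑' C : {C : Finset G // ∃ k ∈ C, k ∈ A}, Φ.unifNorm C.1))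
  unfold localProb
  rw [abs_of_nonneg (div_nonneg h0 hpos.le)]
  refine div_le_one_of_le₀ (le_max_of_le_left ?_) hpos.le
  exact Finset.single_le_sum (f := fun u : A → S => F.localWeight W A B (patch A u p))
    (fun _ _ => F.localWeight_nonneg W A B _) (Finset.mem_univ u)

/-- The link between the Gibbs kernels and weak convergence: the right side is continuous
everywhere, the left side only measurable. The numerators agree by the Markov property, and the
lower cutoff of the denominator is inactive on Ω. -/
theorem prob_eq_localProb (F : Φ.LocalRep) {W : (A : Finset G) → (A → S) → Set Θ}
    (hΦ : Φ.AbsolutelySummable) {A B : Finset G} (hAB : A ⊆ B)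
    (hB : ∀ θ : Θ, ∀ x ∈ R.X θ, ∀ x' ∈ R.X θ,
      (∀ k ∈ B, k ∉ A → x k = x' k) → patchConfig B (fun k => x k) x' ∈ R.X θ)
    {p : Θ × (G → S)} (hp : p.2 ∈ R.X p.1)
    (hpW : ∀ A w, p.1 ∈ W A w ↔ ∃ x ∈ R.X p.1, ∀ k : A, x k = w k) (u : A → S) :
    (F.prob A u p : ℝ) = F.localProb W A B u p := by
  classical
  have hw : ∀ v : A → S, (F.weight A (patch A v p) : ℝ) = F.localWeight W A B (patch A v p) := by
    intro v
    have hiff := patch_mem_iff_admissible hAB hB hp hpW v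
    unfold localWeight
    by_cases h : (patch A v p).2 ∈ R.X (patch A v p).1
    · rw [F.weight_of_mem A h, Set.indicator_of_mem (hiff.1 h), one_mul,
        Real.coe_toNNReal _ (Real.exp_pos _).le]
    · rw [F.weight_of_notMem A h, Set.indicator_of_notMem (mt hiff.2 h), zero_mul, NNReal.coe_zero]
  have hZ : (F.partition A p : ℝ) = ∑ v : A → S, F.localWeight W A B (patch A v p) := by
    rw [partition, NNReal.coe_sum]
    exact Finset.sum_congr rfl fun v _ => hw v
  rw [prob, localProb, NNReal.coe_div, hw, ← hZ, max_eq_left]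
  -- The pattern already present on A contributes a term at least as large as the cutoff.
  have h1 : (F.weight A p : ℝ) ≤ F.partition A p := by exact_mod_cast F.weight_le_partition A p
  refine le_trans ?_ h1
  rw [F.weight_of_mem A hp, Real.coe_toNNReal _ (Real.exp_pos _).le]
  exact Real.exp_le_exp.2 (neg_le_neg (le_of_abs_le (F.abs_condEnergy_le hΦ A p)))

/-- There is a measurable choice of admissible patterns on a given finite set. -/
theorem exists_measurable_pattern [TopologicalSpace Θ] [BorelSpace Θ] [Nonempty S] {F : Φ.LocalRep}
    {ν : Measure Θ} {W : (A : Finset G) → (A → S) → Set Θ} (hW : F.IsAdapted ν W)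
    (hne : ∀ᵐ θ ∂ν, (R.X θ).Nonempty) (A : Finset G) :
    ∃ w : Θ → A → S, Measurable w ∧ ∀ᵐ θ ∂ν, θ ∈ W A (w θ) := by
  classical
  obtain ⟨e, he⟩ := exists_surjective_nat (A → S)
  have hm : ∀ w, MeasurableSet (W A w) := fun w => (hW.isClopen A w).isOpen.measurableSet
  -- The complement makes the search for the first admissible pattern terminate for every
  -- environment. It is ν-null, since X_θ is almost surely nonempty.
  have hex : ∀ θ, ∃ n, θ ∈ W A (e n) ∪ (⋃ w, W A w)ᶜ := by
    intro θ
    by_cases h : θ ∈ ⋃ w, W A w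
    · obtain ⟨w, hw⟩ := Set.mem_iUnion.1 h
      obtain ⟨n, rfl⟩ := he w
      exact ⟨n, Or.inl hw⟩
    · exact ⟨0, Or.inr h⟩
  refine ⟨fun θ => e (Nat.find (hex θ)), (measurable_from_nat (f := e)).comp (measurable_find hex
    fun n => (hm (e n)).union (MeasurableSet.iUnion hm).compl), ?_⟩
  filter_upwards [hne, hW.ae_mem_iff] with θ hθ hθW
  obtain ⟨x, hx⟩ := hθ
  refine (Nat.find_spec (hex θ)).resolve_right fun h => h ?_
  exact Set.mem_iUnion.2 ⟨_, (hθW A fun k => x k).2 ⟨x, hx, fun _ => rfl⟩⟩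

end Adapted

/-! ### Properties that pass to weak limits -/

section Limits

variable {G Θ S : Type*} [Group G] [Countable G] [MulAction G Θ] [MeasurableSpace Θ]
  [Fintype S] [TopologicalSpace S] [DiscreteTopology S] [MeasurableSpace S]
  [MeasurableSingletonClass S]
  {R : RelativeSystem G Θ S} {Φ : R.Interaction} {F : Φ.LocalRep} {ν : Measure Θ}
  [TopologicalSpace Θ] [BorelSpace Θ] {W : (A : Finset G) → (A → S) → Set Θ}

/-- A limit of measures that are asymptotically supported on admissible patterns is supported
on `Ω`. -/
theorem ae_mem_of_tendsto (hW : F.IsAdapted ν W) [IsProbabilityMeasure ν] {l : Filter ℕ} [l.NeBot]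
    {m : ℕ → Measure (Θ × (G → S))} {m' : Measure (Θ × (G → S))}
    (hm : ∀ n, (m n).map Prod.fst = ν) (hm' : m'.map Prod.fst = ν)
    (hlim : ∀ f : Θ × (G → S) → ℝ, Continuous f → (∃ c, ∀ p, |f p| ≤ c) →
      Tendsto (fun n => ∫ p, f p ∂(m n)) l (𝓝 (∫ p, f p ∂m')))
    (hadm : ∀ A, ∀ᶠ n in l, ∀ᵐ p ∂(m n), p ∈ admissible W A) :
    ∀ᵐ p ∂m', p.2 ∈ R.X p.1 := by
  have hpm := isProbabilityMeasure_of_map_fst hm'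
  have hA : ∀ A, ∀ᵐ p ∂m', p ∈ admissible W A := by
    intro A
    have hmeas : MeasurableSet (admissible W A) := (isClopen_admissible hW A).isOpen.measurableSet
    have h1 := hlim _ (continuous_indicator_admissible hW A) ⟨1, fun p => by
      by_cases hp : p ∈ admissible W A <;> simp [hp]⟩
    have h2 : Tendsto (fun n => ∫ p, (admissible W A).indicator (fun _ => (1 : ℝ)) p ∂(m n)) l
        (𝓝 1) := by
      refine tendsto_const_nhds.congr' ?_
      filter_upwards [hadm A] with n hn
      have := isProbabilityMeasure_of_map_fst (hm n)
      rw [integral_indicator_const _ hmeas, Measure.real, (prob_compl_eq_zero_iff hmeas).1 hn]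
      simp
    have h3 := tendsto_nhds_unique h1 h2
    rw [integral_indicator_const _ hmeas, smul_eq_mul, mul_one] at h3
    refine (prob_compl_eq_zero_iff hmeas).2 ?_
    rwa [Measure.real, ENNReal.toReal_eq_one_iff] at h3
  filter_upwards [ae_all_iff.2 hA, ae_of_map_fst hm' hW.ae_mem_iff] with p hp hpW
  exact R.mem_of_forall_pattern fun A => (hpW A _).1 (hp A)

variable [TopologicalSpace.PseudoMetrizableSpace Θ]

/-- Invariance under resampling passes to limits. -/
theorem resample_eq_of_tendsto (hW : F.IsAdapted ν W) [IsProbabilityMeasure ν]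
    (hTMP : R.RelativeWeakTMP) (hΦ : Φ.AbsolutelySummable) {l : Filter ℕ} [l.NeBot]
    {m : ℕ → Measure (Θ × (G → S))} {m' : Measure (Θ × (G → S))}
    (hm : ∀ n, (m n).map Prod.fst = ν) (hm' : m'.map Prod.fst = ν)
    (hmem : ∀ n, ∀ᵐ p ∂(m n), p.2 ∈ R.X p.1) (hmem' : ∀ᵐ p ∂m', p.2 ∈ R.X p.1)
    (hlim : ∀ f : Θ × (G → S) → ℝ, Continuous f → (∃ c, ∀ p, |f p| ≤ c) →
      Tendsto (fun n => ∫ p, f p ∂(m n)) l (𝓝 (∫ p, f p ∂m')))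
    {A : Finset G} (hA : ∀ᶠ n in l, F.resample A (m n) = m n) : F.resample A m' = m' := by
  classical
  obtain ⟨B, hAB, hB⟩ := hTMP A
  have hpm' := isProbabilityMeasure_of_map_fst hm'
  have hpr : IsProbabilityMeasure (F.resample A m') :=
    isProbabilityMeasure_of_map_fst (ν := ν) (by rw [F.map_fst_resample hΦ A hmem', hm'])
  refine ext_of_forall_integral_eq_of_IsFiniteMeasure fun f => ?_
  let h : Θ × (G → S) → ℝ := fun p => ∑ u : A → S, F.localProb W A B u p * f (patch A u p)
  -- The marginal ν is what makes the exceptional null set of environments harmless, for the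
  -- approximating measures and for the limit alike.
  have hloc : ∀ m : Measure (Θ × (G → S)), m.map Prod.fst = ν → (∀ᵐ p ∂m, p.2 ∈ R.X p.1) →
      ∫ p, f p ∂(F.resample A m) = ∫ p, h p ∂m := by
    intro m hm hmem
    have := isProbabilityMeasure_of_map_fst hm
    rw [F.integral_resample hΦ A m f.continuous.measurable f.norm_coe_le_norm]
    refine integral_congr_ae ?_
    filter_upwards [hmem, ae_of_map_fst hm hW.ae_mem_iff] with p hp hpW
    exact Finset.sum_congr rfl fun u _ => by rw [F.prob_eq_localProb hΦ hAB hB hp hpW u]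
  have hcont : Continuous h := continuous_finsetSum _ fun u _ =>
    (continuous_localProb hW hΦ A B u).mul (f.continuous.comp (continuous_patch A u))
  have hbd : ∀ p, |h p| ≤ ∑ _u : A → S, ‖f‖ := by
    intro p
    refine (Finset.abs_sum_le_sum_abs _ _).trans (Finset.sum_le_sum fun u _ => ?_)
    rw [abs_mul]
    exact (mul_le_of_le_one_left (abs_nonneg _) (F.abs_localProb_le W A B u p)).trans
      (f.norm_coe_le_norm _)
  rw [hloc m' hm' hmem']
  refine tendsto_nhds_unique (hlim h hcont ⟨_, hbd⟩)
    ((hlim f f.continuous ⟨_, f.norm_coe_le_norm⟩).congr' ?_)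
  filter_upwards [hA] with n hn
  rw [← hloc (m n) (hm n) (hmem n), hn]

variable [T2Space Θ] [SecondCountableTopology Θ]

/-- There is a measure on `Ω` with marginal `ν`. -/
theorem exists_measure_map_fst_eq (hW : F.IsAdapted ν W) [IsProbabilityMeasure ν]
    (hν : IsTightMeasureSet {ν}) (hne : ∀ᵐ θ ∂ν, (R.X θ).Nonempty) :
    ∃ m : Measure (Θ × (G → S)), m.map Prod.fst = ν ∧ ∀ᵐ p ∂m, p.2 ∈ R.X p.1 := by
  have hS : Nonempty S := by
    obtain ⟨θ, x, -⟩ := hne.exists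
    exact ⟨x 1⟩
  obtain ⟨B, hB⟩ := exists_finset_exhaustion G
  choose w hwm hw using fun n => exists_measurable_pattern hW hne (B n)
  -- No measurable section of Ω is needed: only the pattern on Bₙ is chosen to be extendable, and
  -- the rest is an arbitrary letter. The graph measures may miss Ω, but each fixed finite pattern
  -- is eventually admissible.
  let ι : ℕ → Θ → Θ × (G → S) := fun n θ =>
    patch (B n) (w n θ) (θ, fun _ => Classical.arbitrary S)
  have hι : ∀ n, Measurable (ι n) := by
    intro n
    refine measurable_id.prodMk (measurable_pi_lambda _ fun k => ?_)
    by_cases hk : k ∈ B n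
    · simp only [patchConfig, hk, dif_pos]
      exact (measurable_pi_apply _).comp (hwm n)
    · simp only [patchConfig, hk, dif_neg, not_false_eq_true]
      exact measurable_const
  have hfst : ∀ n, (ν.map (ι n)).map Prod.fst = ν := fun n => by
    rw [Measure.map_map measurable_fst (hι n)]
    exact Measure.map_id
  obtain ⟨𝒰, m', h𝒰, -, hm', hlim⟩ := exists_tendsto_integral_of_map_fst_eq ν hν
    (fun n => ν.map (ι n)) (fun n => isProbabilityMeasure_of_map_fst (hfst n)) hfst
  refine ⟨m', hm', ae_mem_of_tendsto hW hfst hm' hlim fun A => ?_⟩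
  filter_upwards [h𝒰 (hB A)] with n hn
  refine (ae_map_iff (hι n).aemeasurable (isClopen_admissible hW A).isOpen.measurableSet).2 ?_
  filter_upwards [hw n, hW.ae_mem_iff] with θ hθ hθW
  obtain ⟨x, hx, hxw⟩ := (hθW _ _).1 hθ
  refine (hθW A _).2 ⟨x, hx, fun k => ?_⟩
  rw [patch_snd_of_mem _ _ (hn k.2)]
  exact hxw ⟨k, hn k.2⟩

end Limits

end LocalRep

end Interaction

end RelativeSystem

/-! ### Følner averages -/

theorem abs_sum_sub_sum_le_card_symmDiff {ι : Type*} [DecidableEq ι] (s t : Finset ι) (a : ι → ℝ)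
    {c : ℝ} (ha : ∀ i, |a i| ≤ c) : |∑ i ∈ s, a i - ∑ i ∈ t, a i| ≤ c * (s ∆ t).card := by
  have h1 : ∑ i ∈ s, a i - ∑ i ∈ t, a i = ∑ i ∈ s \ t, a i - ∑ i ∈ t \ s, a i := by
    rw [← Finset.sum_inter_add_sum_sdiff s t, ← Finset.sum_inter_add_sum_sdiff t s,
      Finset.inter_comm t s]
    ring
  have h2 : (s ∆ t).card = (s \ t).card + (t \ s).card := by
    rw [symmDiff_def, Finset.sup_eq_union, Finset.card_union_of_disjoint disjoint_sdiff_sdiff]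
  have h3 : ∀ r : Finset ι, |∑ i ∈ r, a i| ≤ c * r.card := fun r =>
    (Finset.abs_sum_le_sum_abs _ _).trans
      ((Finset.sum_le_card_nsmul r _ c fun i _ => ha i).trans_eq (by rw [nsmul_eq_mul, mul_comm]))
  rw [h1, h2, Nat.cast_add, mul_add]
  exact (abs_sub _ _).trans (add_le_add (h3 _) (h3 _))

namespace RelativeSystem

namespace Interaction

namespace LocalRep

open scoped NNReal ENNReal

section Average

variable {G Θ S : Type*} [Group G] [MulAction G Θ] [MeasurableSpace Θ] [MeasurableSpace S]

/-- The average of the translates of a measure by the inverses of the elements of `E`. -/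
noncomputable def average (E : Finset G) (m : Measure (Θ × (G → S))) : Measure (Θ × (G → S)) :=
  (E.card : ℝ≥0∞)⁻¹ • ∑ h ∈ E, m.map (diagAct h⁻¹)

theorem lintegral_average (E : Finset G) (m : Measure (Θ × (G → S)))
    (g : Θ × (G → S) → ℝ≥0∞) :
    ∫⁻ p, g p ∂(average E m) = (E.card : ℝ≥0∞)⁻¹ * ∑ h ∈ E, ∫⁻ p, g p ∂(m.map (diagAct h⁻¹)) := by
  rw [average, lintegral_smul_measure, lintegral_finsetSum_measure, smul_eq_mul]

theorem map_fst_average [MeasurableConstSMul G Θ] {E : Finset G} (hE : E.Nonempty)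
    {m : Measure (Θ × (G → S))} {ν : Measure Θ} (hm : m.map Prod.fst = ν)
    (hν : ∀ g : G, MeasurePreserving (fun θ : Θ => g • θ) ν ν) :
    (average E m).map Prod.fst = ν := by
  refine Measure.ext_of_lintegral _ fun g hg => ?_
  rw [lintegral_map hg measurable_fst, lintegral_average]
  have h : ∀ h ∈ E, ∫⁻ p, g p.1 ∂(m.map (diagAct h⁻¹)) = ∫⁻ θ, g θ ∂ν := by
    intro h _
    rw [lintegral_map (f := fun p : Θ × (G → S) => g p.1) (hg.comp measurable_fst)
      (measurable_diagAct _), ← (hν h⁻¹).lintegral_comp hg,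
      ← hm, lintegral_map (f := fun θ => g (h⁻¹ • θ)) (hg.comp (measurable_const_smul _))
        measurable_fst]
    rfl
  rw [Finset.sum_congr rfl h, Finset.sum_const, nsmul_eq_mul, ← mul_assoc,
    ENNReal.inv_mul_cancel (by exact_mod_cast hE.card_ne_zero) (ENNReal.natCast_ne_top _), one_mul]

theorem integral_average [MeasurableConstSMul G Θ] (E : Finset G) (m : Measure (Θ × (G → S)))
    [IsFiniteMeasure m] {f : Θ × (G → S) → ℝ} (hf : Measurable f) {c : ℝ} (hc : ∀ p, |f p| ≤ c) :
    ∫ p, f p ∂(average E m) = (E.card : ℝ)⁻¹ * ∑ h ∈ E, ∫ p, f (diagAct h⁻¹ p) ∂m := by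
  rw [average, integral_smul_measure, integral_finsetSum_measure]
  · rw [ENNReal.toReal_inv, ENNReal.toReal_natCast, smul_eq_mul]
    congr 1
    exact Finset.sum_congr rfl fun h _ =>
      integral_map (measurable_diagAct _).aemeasurable hf.aestronglyMeasurable
  · exact fun h _ => Integrable.of_bound hf.aestronglyMeasurable c (Eventually.of_forall hc)

/-- Since gh⁻¹ = (hg⁻¹)⁻¹, acting by g replaces the index set E by Eg⁻¹. Averaging over inverses is
therefore what matches a right Følner sequence. -/
theorem abs_integral_average_sub_le [MeasurableConstSMul G Θ] (E : Finset G) (g : G)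
    (m : Measure (Θ × (G → S))) [IsProbabilityMeasure m] {f : Θ × (G → S) → ℝ} (hf : Measurable f)
    {c : ℝ} (hc : ∀ p, |f p| ≤ c) :
    |∫ p, f (diagAct g p) ∂(average E m) - ∫ p, f p ∂(average E m)| ≤
      c * ((((E : Set G) ∆ ((fun h => h * g⁻¹) '' (E : Set G))).ncard : ℝ) / (E.card : ℝ)) := by
  classical
  rw [integral_average (f := fun p => f (diagAct g p)) E m (hf.comp (measurable_diagAct g)) (fun p => hc _),
    integral_average E m hf hc, ← mul_sub, abs_mul, abs_of_nonneg (by positivity)]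
  let a : G → ℝ := fun h => ∫ p, f (diagAct h⁻¹ p) ∂m
  have ha : ∀ h, |a h| ≤ c := fun h => by
    have := norm_integral_le_of_norm_le_const (μ := m) (f := fun p => f (diagAct h⁻¹ p)) (C := c)
      (Eventually.of_forall fun p => hc (diagAct h⁻¹ p))
    simpa using this
  have h1 : ∑ h ∈ E, ∫ p, f (diagAct g (diagAct h⁻¹ p)) ∂m =
      ∑ h ∈ E.image (fun h => h * g⁻¹), a h := by
    rw [Finset.sum_image fun x _ y _ h => mul_right_cancel h]
    refine Finset.sum_congr rfl fun h _ => ?_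
    simp only [a, mul_inv_rev, inv_inv, diagAct_mul]
  have h2 : ((E : Set G) ∆ ((fun h => h * g⁻¹) '' (E : Set G))).ncard =
      (E.image (fun h => h * g⁻¹) ∆ E).card := by
    rw [symmDiff_comm, ← Set.ncard_coe_finset, Finset.coe_symmDiff, Finset.coe_image]
  rw [h1, h2, div_eq_inv_mul, mul_left_comm]
  exact mul_le_mul_of_nonneg_left (abs_sum_sub_sum_le_card_symmDiff _ _ a ha) (by positivity)

end Average

/-! ### Construction of the invariant measure -/

section Existence

variable {G Θ S : Type*} [Group G] [Countable G] [MulAction G Θ] [MeasurableSpace Θ]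
  [MeasurableConstSMul G Θ] [TopologicalSpace S] [MeasurableSpace S]
  {R : RelativeSystem G Θ S}

theorem ae_mem_average (E : Finset G) {m : Measure (Θ × (G → S))}
    (hm : ∀ᵐ p ∂m, p.2 ∈ R.X p.1) : ∀ᵐ p ∂(average E m), p.2 ∈ R.X p.1 := by
  refine Measure.ae_smul_measure ?_ _
  rw [← Measure.sum_coe_finset, Measure.ae_sum_iff]
  intro h
  rw [ae_map_iff (measurable_diagAct _).aemeasurable R.measurableSet_total]
  filter_upwards [hm] with p hp
  exact (R.act (h : G)⁻¹ ⟨p, hp⟩).2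

variable [Fintype S] {Φ : R.Interaction} (F : Φ.LocalRep)

/-- By equivariance, translating by h⁻¹ turns invariance under resampling on hA into invariance on
A, and resampling is linear in the measure. -/
theorem resample_average (hΦ : Φ.AbsolutelySummable) {A E : Finset G} {m : Measure (Θ × (G → S))}
    (hm : ∀ h ∈ E, F.resample (A.map (mulLeftEmbedding h)) m = m) :
    F.resample A (average E m) = average E m := by
  classical
  have h1 : ∀ h ∈ E, F.resample A (m.map (diagAct h⁻¹)) = m.map (diagAct h⁻¹) := by
    intro h hh
    have hA : A = (A.map (mulLeftEmbedding h)).map (mulLeftEmbedding h⁻¹) := by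
      ext k
      simp
    conv_lhs => rw [hA]
    rw [F.resample_map_diagAct hΦ, hm h hh]
  refine Measure.ext_of_lintegral _ fun g hg => ?_
  rw [F.lintegral_resample hΦ A _ hg, lintegral_average, lintegral_average]
  congr 1
  refine Finset.sum_congr rfl fun h hh => ?_
  rw [← F.lintegral_resample hΦ A _ hg, h1 h hh]

theorem exists_invariant_resample_eq [StandardBorelSpace Θ] [DiscreteTopology S]
    [MeasurableSingletonClass S] (hG : HasRightFolnerSequence G) (hTMP : R.RelativeWeakTMP)
    (hΦ : Φ.AbsolutelySummable) (ν : Measure Θ) [IsProbabilityMeasure ν]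
    (hν : ∀ g : G, MeasurePreserving (fun θ : Θ => g • θ) ν ν)
    (hne : ∀ᵐ θ ∂ν, (R.X θ).Nonempty) :
    ∃ m : Measure (Θ × (G → S)), m.map Prod.fst = ν ∧ (∀ᵐ p ∂m, p.2 ∈ R.X p.1) ∧
      (∀ A, F.resample A m = m) ∧ ∀ g : G, m.map (diagAct g) = m := by
  classical
  obtain ⟨τ, W, _, _, _, _, hact, htight, hW⟩ := F.exists_isAdapted ν
  obtain ⟨m₀, hm₀, hmem₀⟩ := exists_measure_map_fst_eq hW htight hne
  obtain ⟨E, hEne, hE⟩ := hG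
  obtain ⟨B, hB⟩ := exists_finset_exhaustion G
  -- Large enough to contain hA for every h in Eₙ as soon as A ⊆ Bₙ, which is what averaging over Eₙ
  -- requires.
  let D : ℕ → Finset G := fun n => (E n).biUnion fun h => (B n).map (mulLeftEmbedding h)
  let r : ℕ → Measure (Θ × (G → S)) := fun n => F.resample (D n) m₀
  have hr : ∀ n, (r n).map Prod.fst = ν := fun n => by rw [F.map_fst_resample hΦ _ hmem₀, hm₀]
  have hrp : ∀ n, IsProbabilityMeasure (r n) := fun n => isProbabilityMeasure_of_map_fst (hr n)
  let m : ℕ → Measure (Θ × (G → S)) := fun n => average (E n) (r n)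
  have hm : ∀ n, (m n).map Prod.fst = ν := fun n => map_fst_average (hEne n) (hr n) hν
  have hmem : ∀ n, ∀ᵐ p ∂(m n), p.2 ∈ R.X p.1 := fun n =>
    ae_mem_average (E n) (F.ae_mem_resample hΦ _ _)
  have hres : ∀ A, ∀ᶠ n in atTop, F.resample A (m n) = m n := by
    intro A
    filter_upwards [hB A] with n hn
    refine F.resample_average hΦ fun h hh => F.resample_resample hΦ ?_ _
    exact (Finset.map_subset_map.2 hn).trans
      (Finset.subset_biUnion_of_mem (fun h => (B n).map (mulLeftEmbedding h)) hh)
  obtain ⟨𝒰, m', h𝒰, _, hm', hlim⟩ := exists_tendsto_integral_of_map_fst_eq ν htight m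
    (fun n => isProbabilityMeasure_of_map_fst (hm n)) hm
  have hmem' : ∀ᵐ p ∂m', p.2 ∈ R.X p.1 := by
    refine ae_mem_of_tendsto hW hm hm' hlim fun A => Eventually.of_forall fun n => ?_
    filter_upwards [hmem n, ae_of_map_fst (hm n) hW.ae_mem_iff] with p hp hpW
    exact (hpW A _).2 ⟨p.2, hp, fun _ => rfl⟩
  refine ⟨m', hm', hmem', fun A => resample_eq_of_tendsto hW hTMP hΦ hm hm' hmem hmem' hlim
    (h𝒰 (hres A)), fun g => ?_⟩
  have : IsProbabilityMeasure (m'.map (diagAct g)) :=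
    Measure.isProbabilityMeasure_map (measurable_diagAct g).aemeasurable
  refine ext_of_forall_integral_eq_of_IsFiniteMeasure fun f => ?_
  rw [integral_map (measurable_diagAct g).aemeasurable f.continuous.measurable.aestronglyMeasurable]
  have h1 := hlim _ (f.continuous.comp (continuous_diagAct g (hact g)))
    ⟨‖f‖, fun p => f.norm_coe_le_norm _⟩
  have h2 := hlim f f.continuous ⟨‖f‖, f.norm_coe_le_norm⟩
  refine sub_eq_zero.1 (tendsto_nhds_unique (h1.sub h2) (squeeze_zero_norm (fun n =>
    abs_integral_average_sub_le (E n) g (r n) f.continuous.measurable f.norm_coe_le_norm) ?_))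
  -- The defect is at most ‖f‖ times the Følner ratio for g⁻¹.
  simpa using ((hE g⁻¹).const_mul ‖f‖).mono_left h𝒰

end Existence

end LocalRep

end Interaction

end RelativeSystem

/-! ### Transfer from the product space to Ω -/

theorem mainTheorem10
    {G Θ S : Type*}
    [Group G] [Countable G] (hG : HasRightFolnerSequence G)
    [Fintype S] [TopologicalSpace S] [DiscreteTopology S]
    [MeasurableSpace S] [MeasurableSingletonClass S]
    [MeasurableSpace Θ] [StandardBorelSpace Θ] [MulAction G Θ] [MeasurableConstSMul G Θ]
    (R : RelativeSystem G Θ S) (hTMP : R.RelativeWeakTMP)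
    (Φ : R.Interaction) (hΦ : Φ.AbsolutelySummable)
    (ν : MeasureTheory.Measure Θ) [MeasureTheory.IsProbabilityMeasure ν]
    (hν : ∀ g : G, MeasureTheory.MeasurePreserving (fun θ : Θ => g • θ) ν ν)
    (hne : ∀ᵐ θ ∂ν, (R.X θ).Nonempty) :
    ∃ μ : MeasureTheory.Measure R.Omega,
      Φ.IsRelativeGibbs μ ∧
      (∀ g : G, MeasureTheory.MeasurePreserving (R.act g) μ μ) ∧
      μ.map R.env = ν := by
  obtain ⟨F⟩ := Φ.nonempty_localRep
  obtain ⟨m, hm, hmem, hres, hinv⟩ := F.exists_invariant_resample_eq hG hTMP hΦ ν hν hne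
  have hval : MeasurableEmbedding (Subtype.val : R.Omega → Θ × (G → S)) :=
    MeasurableEmbedding.subtype_coe R.measurableSet_total
  have hmap : (m.comap Subtype.val).map (Subtype.val : R.Omega → Θ × (G → S)) = m := by
    rw [hval.map_comap, Subtype.range_coe_subtype]
    exact Measure.restrict_eq_self_of_ae_mem hmem
  have hpm : IsProbabilityMeasure m := RelativeSystem.isProbabilityMeasure_of_map_fst hm
  have hp : IsProbabilityMeasure (m.comap (Subtype.val : R.Omega → Θ × (G → S))) := by
    constructor
    rw [← Set.preimage_univ (f := Subtype.val), ← Measure.map_apply hval.measurable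
      MeasurableSet.univ, hmap, measure_univ]
  have hact : ∀ g : G, Measurable (R.act g) := fun g =>
    ((RelativeSystem.measurable_diagAct g).comp hval.measurable).subtype_mk
  refine ⟨m.comap Subtype.val, F.isRelativeGibbs_of_resample_eq hΦ _ fun A => ?_,
    fun g => ⟨hact g, ?_⟩, ?_⟩
  · rw [hmap, hres A]
  -- A measure on Ω is determined by its image in the product, where invariance is already known.
  · rw [← hval.comap_map ((m.comap Subtype.val).map (R.act g)), Measure.map_map hval.measurable
      (hact g)]
    have h : Subtype.val ∘ R.act g = RelativeSystem.diagAct g ∘ Subtype.val := rfl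
    rw [h, ← Measure.map_map (RelativeSystem.measurable_diagAct g) hval.measurable, hmap, hinv g]
  · rw [← hm]
    conv_rhs => rw [← hmap]
    rw [Measure.map_map measurable_fst hval.measurable]
    rfl
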